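/- **Setting.** Let $H$ be a complex Hilbert space with a fixed orthonormal basis $(e_n)_{n\ge 1}$; operators in $B(H)$ are identified with their infinite matrices $A_{ij}=\langle Ae_j,e_i\rangle$. Let $\mathrm{c}_0^*$ be the set of nonnegative nonincreasing real sequences converging to $0$. For a bounded sequence $\rho$, $\operatorname{diag}\rho$ is the diagonal operator $e_n\mapsto\rho_ne_n$, and $E(A)$ is the diagonal operator with the same main diagonal as $A\in B(H)$. For $\xi,\eta\in \mathrm{c}_0^*$ write - $\xi\prec\eta$ (majorization) if $\sum_{j=1}^n\xi_j\le\sum_{j=1}^n\eta_j$ for every $n$; - $\xi\preccurlyeq\eta$ (strong majorization) if $\xi\prec\eta$ and $\liminf_n\sum_{j=1}^n(\eta_j-\xi_j)=0$; - $\xi\prec_b\eta$ (block majorization) if $\xi\prec\eta$ and $\sum_{j=1}^{n_k}\xi_j=\sum_{j=1}^{n_k}\eta_j$ for some strictly increasing sequence of indices $n_k$. An infinite real matrix $P=(P_{ij})$ is substochastic if its entries are nonnegative and all its row and column sums are at most $1$; $P\eta$ is the sequence $\big(\sum_jP_{ij}\eta_j\big)_i$. An orthogonal matrix is a unitary operator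 with real entries. A direct sum of finite orthogonal matrices is an orthogonal matrix that is block diagonal for a partition of $\mathbb N$ into consecutive finite intervals. A matrix $Q$ is orthostochastic (respectively block orthostochastic) if $Q_{ij}=|U_{ij}|^2$ for an orthogonal matrix $U$ (respectively a direct sum $U$ of finite orthogonal matrices). For a compact operator $X$, $s(X)\in \mathrm{c}_0^*$ is the sequence of its singular numbers: the positive eigenvalues of $|X|=(X^*X)^{1/2}$ in nonincreasing order, repeated according to multiplicity, followed by zeros if there are only finitely many. For a two-sided ideal $I$ of $B(H)$ let $\Sigma(I)=\{s(X)\mid X\in I \text{ compact}\}$ be its characteristic set (every element of an ideal $I\neq B(H)$ is compact). For a sequence $\xi$ let $\xi_a=\big(\tfrac1n\sum_{j=1}^n\xi_j\big)_n$. The ideals $I_a$ and ${}_aI$ are the ideals generated by the operators $\operatorname{diag}\xi$ with $\xi$ in, respectively, $$\{\xi\in \mathrm{c}_0^*\mid \exists\,\eta\in\Sigma(I),\ M>0:\ \xi_n\le M(\eta_a)_n\ \text{for all } n\}\quad\text{and}\quad\{\xi\in \mathrm{c}_0^*\mid\xi_a\in\Sigma(I)\};$$ they are the ideals with these characteristic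 sets. The am-closure of $I$ is $I^-={}_a(I_a)$. Let $\mathscr L_1$ be the ideal of trace class operators. **Theorem.** Let $I$ be a two-sided ideal of $B(H)$ and let $\xi\in \mathrm{c}_0^*$. The following conditions are equivalent. - (i) $\xi\in\Sigma(I^-)$. - (ii) $\xi\prec\eta$ for some $\eta\in\Sigma(I)$. - (ii$'$) $\xi\preccurlyeq\eta$ for some $\eta\in\Sigma(I)$. - (iii) $\xi=P\eta$ for some $\eta\in\Sigma(I)$ and some substochastic matrix $P$. - (iii$'$) $\xi=Q\eta$ for some $\eta\in\Sigma(I)$ and some orthostochastic matrix $Q$. - (iv) $\operatorname{diag}\xi=E(L\operatorname{diag}\eta\,L^*)$ for some $\eta\in\Sigma(I)$ and some contraction $L$. - (iv$'$) $\operatorname{diag}\xi=E(U\operatorname{diag}\eta\,U^*)$ for some $\eta\in\Sigma(I)$ and some orthogonal matrix $U$. If $I\supseteq\mathscr L_1$, these conditions are also equivalent to each of the following. - (ii$''$) $\xi\prec_b\eta$ for some $\eta\in\Sigma(I)$. - (iii$''$) $\xi=Q\eta$ for some $\eta\in\Sigma(I)$ and some block orthostochastic matrix $Q$. - (iv$''$)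 $\operatorname{diag}\xi=E(U\operatorname{diag}\eta\,U^*)$ for some $\eta\in\Sigma(I)$ and some direct sum $U$ of finite orthogonal matrices. -/

import Mathlib

open Filter Topology
open scoped ENNReal InnerProductSpace

namespace AMClosure

noncomputable section

/-! ### Sequences

Sequences are indexed from `0`: the entry written `ξ_j` with `j ≥ 1` on paper is `ξ (j - 1)`. -/

/-- The cone of nonnegative nonincreasing real sequences converging to `0`. -/
structure IsNullDecr (ξ : ℕ → ℝ) : Prop where
  nonneg : ∀ n, 0 ≤ ξ n
  antitone : Antitone ξ
  tendsto_zero : Tendsto ξ atTop (𝓝 0)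

/-- `ξ ≺ η`: the partial sums of `ξ` are at most those of `η`. -/
def Majorized (ξ η : ℕ → ℝ) : Prop :=
  ∀ n, ∑ j ∈ Finset.range n, ξ j ≤ ∑ j ∈ Finset.range n, η j

/-- `ξ ≼ η`: `ξ ≺ η` and `liminf_n ∑_{j ≤ n} (η_j - ξ_j) = 0`, the lower limit being
taken in the extended reals, so that it exists also when the sums tend to infinity. -/
def StronglyMajorized (ξ η : ℕ → ℝ) : Prop :=
  Majorized ξ η ∧
    liminf (fun n : ℕ => ((∑ j ∈ Finset.range n, (η j - ξ j) : ℝ) : EReal)) atTop = 0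

/-- `ξ ≺_b η`: `ξ ≺ η` and the partial sums agree along some strictly increasing sequence
of indices. -/
def BlockMajorized (ξ η : ℕ → ℝ) : Prop :=
  Majorized ξ η ∧ ∃ n : ℕ → ℕ, StrictMono n ∧
    ∀ k, ∑ j ∈ Finset.range (n k), ξ j = ∑ j ∈ Finset.range (n k), η j

/-- The sequence `ξ_a` of arithmetic means of `ξ`. -/
def arithSeq (ξ : ℕ → ℝ) (n : ℕ) : ℝ :=
  (∑ j ∈ Finset.range (n + 1), ξ j) / (n + 1)

/-! ### Infinite real matrices -/

/-- Nonnegative entries, all row sums and all column sums at most `1`. -/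
structure IsSubstochastic (P : Matrix ℕ ℕ ℝ) : Prop where
  nonneg : ∀ i j, 0 ≤ P i j
  row_summable : ∀ i, Summable fun j => P i j
  row_le : ∀ i, ∑' j, P i j ≤ 1
  col_summable : ∀ j, Summable fun i => P i j
  col_le : ∀ j, ∑' i, P i j ≤ 1

/-- `ξ = P η`, that is, `ξ_i = ∑_j P_ij η_j` (a convergent series) for every `i`. -/
def IsImage (ξ : ℕ → ℝ) (P : Matrix ℕ ℕ ℝ) (η : ℕ → ℝ) : Prop :=
  ∀ i, HasSum (fun j => P i j * η j) (ξ i)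

/-! ### Operators on a Hilbert space with a fixed orthonormal basis -/

variable {H : Type*} [NormedAddCommGroup H] [InnerProductSpace ℂ H] [CompleteSpace H]

/-- The `(i, j)` entry of the matrix of `A` in the basis `e`. -/
def entry (e : HilbertBasis ℕ ℂ H) (A : H →L[ℂ] H) (i j : ℕ) : ℂ :=
  ⟪e i, A (e j)⟫_ℂ

open Classical in
/-- `diag ρ`, the diagonal operator `e_n ↦ ρ_n e_n` of a bounded sequence `ρ`
(it is set to `0` when `ρ` is unbounded, a case that never arises). -/
def diag (e : HilbertBasis ℕ ℂ H) (ρ : ℕ → ℂ) : H →L[ℂ] H :=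
  if h : ∃ K : ℝ, 0 ≤ K ∧ ∀ n, ‖ρ n • ContinuousLinearMap.id ℂ ℂ‖ ≤ K then
    (e.repr.symm.toContinuousLinearEquiv : lp (fun _ : ℕ => ℂ) 2 →L[ℂ] H) ∘L
      lp.mapCLM 2 (fun n => ρ n • ContinuousLinearMap.id ℂ ℂ) h.choose_spec.1 h.choose_spec.2 ∘L
        (e.repr.toContinuousLinearEquiv : H →L[ℂ] lp (fun _ : ℕ => ℂ) 2)
  else 0

/-- `diag ρ` for a real sequence `ρ`. -/
def rdiag (e : HilbertBasis ℕ ℂ H) (ρ : ℕ → ℝ) : H →L[ℂ] H :=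
  diag e fun n => (ρ n : ℂ)

theorem diag_apply_basis (e : HilbertBasis ℕ ℂ H) (ρ : ℕ → ℂ) (K : ℝ)
    (hρ : ∀ n, ‖ρ n‖ ≤ K) (n : ℕ) : diag e ρ (e n) = ρ n • e n := by
  have h : ∃ K : ℝ, 0 ≤ K ∧ ∀ n, ‖ρ n • ContinuousLinearMap.id ℂ ℂ‖ ≤ K := by
    refine ⟨K, (norm_nonneg _).trans (hρ 0), fun n => ?_⟩
    rw [norm_smul]
    simpa using hρ n
  rw [diag, dif_pos h]
  apply e.repr.injective
  ext m
  rcases eq_or_ne m n with rfl | hmn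
  · simp [lp.mapCLM]
  · have h0 : (e.repr (e n) : ∀ _ : ℕ, ℂ) m = 0 := by
      rw [e.repr_self]; simp [hmn]
    simp [lp.mapCLM, h0]

/-- The expectation `E(A)`: the diagonal operator with the same main diagonal as `A`. -/
def expectation (e : HilbertBasis ℕ ℂ H) (A : H →L[ℂ] H) : H →L[ℂ] H :=
  diag e fun n => entry e A n n

/-- `U` is an orthogonal matrix: a unitary operator with real entries. -/
def IsOrthogonal (e : HilbertBasis ℕ ℂ H) (U : H →L[ℂ] H) : Prop :=
  U ∈ unitary (H →L[ℂ] H) ∧ ∀ i j, (entry e U i j).im = 0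

/-- `U` is a direct sum of finite orthogonal matrices: an orthogonal matrix that is block
diagonal for a partition of the indices into consecutive finite intervals
`[n k, n (k + 1))`. -/
def IsBlockOrthogonal (e : HilbertBasis ℕ ℂ H) (U : H →L[ℂ] H) : Prop :=
  IsOrthogonal e U ∧ ∃ n : ℕ → ℕ, n 0 = 0 ∧ StrictMono n ∧
    ∀ i j, entry e U i j ≠ 0 →
      ∃ k, i ∈ Set.Ico (n k) (n (k + 1)) ∧ j ∈ Set.Ico (n k) (n (k + 1))

/-- `Q` is the Schur-square of an orthogonal matrix. -/
def IsOrthostochastic (e : HilbertBasis ℕ ℂ H) (Q : Matrix ℕ ℕ ℝ) : Prop :=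
  ∃ U : H →L[ℂ] H, IsOrthogonal e U ∧ ∀ i j, Q i j = ‖entry e U i j‖ ^ 2

/-- `Q` is the Schur-square of a direct sum of finite orthogonal matrices. -/
def IsBlockOrthostochastic (e : HilbertBasis ℕ ℂ H) (Q : Matrix ℕ ℕ ℝ) : Prop :=
  ∃ U : H →L[ℂ] H, IsBlockOrthogonal e U ∧ ∀ i j, Q i j = ‖entry e U i j‖ ^ 2

/-! ### Operator ideals and their characteristic sets -/

/-- `ξ = s(X)` for the compact operator `X`: `ξ` decreases to `0` and lists the positive
eigenvalues of `|X| = (X* X)^{1/2}`, each as often as its multiplicity, and zeros afterwards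
if there are only finitely many. For compact `X` all these multiplicities are finite, and
there is exactly one such sequence. -/
def IsSNumbers (X : H →L[ℂ] H) (ξ : ℕ → ℝ) : Prop :=
  IsNullDecr ξ ∧ ∀ t : ℝ, 0 < t →
    {n | ξ n = t}.ncard =
      Module.finrank ℂ (Module.End.eigenspace ((CFC.abs X : H →L[ℂ] H) : H →ₗ[ℂ] H) (t : ℂ))

/-- The characteristic set `Σ(I)`: the `s`-number sequences of the compact operators in `I`
(every operator in an ideal other than `B(H)` is compact). -/
def charSet (I : TwoSidedIdeal (H →L[ℂ] H)) : Set (ℕ → ℝ) :=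
  {ξ | ∃ X ∈ I, IsCompactOperator X ∧ IsSNumbers X ξ}

/-- The ideal generated by the operators `diag ξ`, `ξ ∈ S`; if `S` is a characteristic set,
this is the ideal with characteristic set `S`. -/
def idealOf (e : HilbertBasis ℕ ℂ H) (S : Set (ℕ → ℝ)) : TwoSidedIdeal (H →L[ℂ] H) :=
  TwoSidedIdeal.span (rdiag e '' S)

/-- The arithmetic mean ideal `I_a`. -/
def arithMean (e : HilbertBasis ℕ ℂ H) (I : TwoSidedIdeal (H →L[ℂ] H)) :
    TwoSidedIdeal (H →L[ℂ] H) :=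
  idealOf e {ξ | IsNullDecr ξ ∧ ∃ η ∈ charSet I, ∃ M : ℝ, 0 < M ∧
    ∀ n, ξ n ≤ M * arithSeq η n}

/-- The pre-arithmetic mean ideal `_aI`. -/
def preArithMean (e : HilbertBasis ℕ ℂ H) (I : TwoSidedIdeal (H →L[ℂ] H)) :
    TwoSidedIdeal (H →L[ℂ] H) :=
  idealOf e {ξ | IsNullDecr ξ ∧ arithSeq ξ ∈ charSet I}

/-- The am-closure `I⁻ = _a(I_a)`. -/
def amClosure (e : HilbertBasis ℕ ℂ H) (I : TwoSidedIdeal (H →L[ℂ] H)) :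
    TwoSidedIdeal (H →L[ℂ] H) :=
  preArithMean e (arithMean e I)

/-- Trace class operators: `|X|` has finite trace. -/
def IsTraceClass (e : HilbertBasis ℕ ℂ H) (X : H →L[ℂ] H) : Prop :=
  Summable fun n => (entry e (CFC.abs X) n n).re

end

end AMClosure

namespace AMClosure

noncomputable section

/-! ### Diagonal operators and ideals, translated into statements about sequences -/

section

variable {H : Type*} [NormedAddCommGroup H] [InnerProductSpace ℂ H]

/-! ### Expansions in a Hilbert basis -/

/-! Everything is reduced to decreasing null sequences. A sequence lies in `charSet I` exactly when
its diagonal operator lies in `I` (`mem_charSet_iff`), and Gelfand-type bounds compute the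
characteristic set of a generated ideal (`mem_charSet_idealOf_iff`). Since `ξ ≺ M η` means `ξ_a ≤ M
η_a`, the am-closure then consists of the sequences majorized by some element of `charSet I`
(`mem_charSet_amClosure_iff`).

Contractions have substochastic Schur squares, and a substochastic image of `η` is majorized by `η`
(`IsSubstochastic.majorized`), so every matrix condition implies majorization. For the converse,
majorization is sharpened to strong majorization by shrinking `η` to a minimal majorant
(`exists_stronglyMajorized_le`). If the ideal contains the trace class, a further summable
perturbation gives block majorization (`exists_blockMajorized_le_add_summable`).

The core is the construction of an orthogonal matrix from `ξ ≼ η`. The values `ξ 0, ξ 1, …` are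
split off one at a time: a plane rotation of two adjacent basis vectors produces a unit vector on
which the form of `diag η` equals `ξ m`, and the other rotated vector returns to the remaining
system. Strong majorization passes to the remainders and forces their largest entries to `0`
(`remSeq_zero_tendsto`), which makes the vectors split off a complete system
(`eq_zero_of_inner_splitVec`). Where the partial sums of `ξ` and `η` agree, the rotations do not mix
the two sides, so block majorization yields a block matrix. -/

theorem ext_inner_basis (e : HilbertBasis ℕ ℂ H) {x y : H}
    (h : ∀ n, ⟪e n, x⟫_ℂ = ⟪e n, y⟫_ℂ) : x = y := by
  apply e.repr.injective
  ext n
  rw [e.repr_apply_apply, e.repr_apply_apply, h n]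

theorem inner_basis (e : HilbertBasis ℕ ℂ H) (m n : ℕ) :
    ⟪e m, e n⟫_ℂ = if m = n then 1 else 0 :=
  orthonormal_iff_ite.1 e.orthonormal m n

theorem hasSum_sq_norm_inner (e : HilbertBasis ℕ ℂ H) (x : H) :
    HasSum (fun n => ‖⟪e n, x⟫_ℂ‖ ^ 2) (‖x‖ ^ 2) := by
  have h := (e.hasSum_inner_mul_inner x x).mapL Complex.reCLM
  have h1 : Complex.reCLM ⟪x, x⟫_ℂ = ‖x‖ ^ 2 := by
    rw [inner_self_eq_norm_sq_to_K]
    simp [← Complex.ofReal_pow]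
  rw [h1] at h
  convert h using 2 with n
  rw [← inner_conj_symm x (e n), Complex.conj_mul']
  simp [← Complex.ofReal_pow]

/-! ### Diagonal operators -/

/-- Bounded sequences of scalars. -/
def BddSeq (ρ : ℕ → ℂ) : Prop := ∃ K : ℝ, ∀ n, ‖ρ n‖ ≤ K

theorem inner_diag (e : HilbertBasis ℕ ℂ H) {ρ : ℕ → ℂ} (hρ : BddSeq ρ) (m : ℕ) (x : H) :
    ⟪e m, diag e ρ x⟫_ℂ = ρ m * ⟪e m, x⟫_ℂ := by
  obtain ⟨K, hK⟩ := hρ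
  have h : ∃ K : ℝ, 0 ≤ K ∧ ∀ n, ‖ρ n • ContinuousLinearMap.id ℂ ℂ‖ ≤ K := by
    refine ⟨K, (norm_nonneg _).trans (hK 0), fun n => ?_⟩
    rw [norm_smul]
    simpa using hK n
  rw [diag, dif_pos h, ← e.repr_apply_apply, ← e.repr_apply_apply]
  simp [lp.mapCLM]

theorem norm_diag_le (e : HilbertBasis ℕ ℂ H) {ρ : ℕ → ℂ} {K : ℝ} (hK : ∀ n, ‖ρ n‖ ≤ K) :
    ‖diag e ρ‖ ≤ K := by
  have hK0 : 0 ≤ K := (norm_nonneg _).trans (hK 0)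
  refine ContinuousLinearMap.opNorm_le_bound _ hK0 fun x => ?_
  refine le_of_sq_le_sq ?_ (by positivity)
  rw [mul_pow]
  refine hasSum_le (fun n => ?_) (hasSum_sq_norm_inner e _)
    ((hasSum_sq_norm_inner e x).mul_left (K ^ 2))
  rw [inner_diag e ⟨K, hK⟩, norm_mul, mul_pow]
  gcongr
  exact hK n

theorem op_ext (e : HilbertBasis ℕ ℂ H) {A B : H →L[ℂ] H}
    (h : ∀ m x, ⟪e m, A x⟫_ℂ = ⟪e m, B x⟫_ℂ) : A = B :=
  ContinuousLinearMap.ext fun x => ext_inner_basis e fun m => h m x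

theorem op_ext_basis (e : HilbertBasis ℕ ℂ H) {A B : H →L[ℂ] H}
    (h : ∀ n, A (e n) = B (e n)) : A = B := by
  refine ContinuousLinearMap.ext_on (s := Set.range e) ?_ ?_
  · have := e.dense_span
    rwa [← Submodule.dense_iff_topologicalClosure_eq_top] at this
  · rintro _ ⟨n, rfl⟩
    exact h n

theorem BddSeq.ofReal {ρ : ℕ → ℝ} {K : ℝ} (h : ∀ n, |ρ n| ≤ K) :
    BddSeq fun n => (ρ n : ℂ) :=
  ⟨K, fun n => by simpa using h n⟩

theorem IsNullDecr.le_zero_index {ξ : ℕ → ℝ} (h : IsNullDecr ξ) (n : ℕ) : ξ n ≤ ξ 0 :=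
  h.antitone (Nat.zero_le n)

theorem IsNullDecr.bddSeq {ξ : ℕ → ℝ} (h : IsNullDecr ξ) : BddSeq fun n => (ξ n : ℂ) :=
  BddSeq.ofReal (K := ξ 0) fun n => by
    rw [abs_of_nonneg (h.nonneg n)]; exact h.le_zero_index n

theorem rdiag_add (e : HilbertBasis ℕ ℂ H) {ρ σ : ℕ → ℝ}
    (hρ : BddSeq fun n => (ρ n : ℂ)) (hσ : BddSeq fun n => (σ n : ℂ)) :
    rdiag e (fun n => ρ n + σ n) = rdiag e ρ + rdiag e σ := by
  obtain ⟨K, hK⟩ := hρ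
  obtain ⟨L, hL⟩ := hσ
  refine op_ext e fun m x => ?_
  rw [add_apply, inner_add_right, rdiag, rdiag, rdiag,
    inner_diag e ⟨K, hK⟩, inner_diag e ⟨L, hL⟩, inner_diag e ⟨K + L, fun n => ?_⟩]
  · push_cast; ring
  · push_cast
    exact (norm_add_le _ _).trans (add_le_add (hK n) (hL n))

theorem rdiag_mul (e : HilbertBasis ℕ ℂ H) {ρ σ : ℕ → ℝ}
    (hρ : BddSeq fun n => (ρ n : ℂ)) (hσ : BddSeq fun n => (σ n : ℂ)) :
    rdiag e (fun n => ρ n * σ n) = rdiag e ρ * rdiag e σ := by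
  obtain ⟨K, hK⟩ := hρ
  obtain ⟨L, hL⟩ := hσ
  refine op_ext e fun m x => ?_
  rw [mul_apply_eq_comp, rdiag, rdiag, rdiag,
    inner_diag e ⟨K, hK⟩, inner_diag e ⟨L, hL⟩, inner_diag e ⟨K * L, fun n => ?_⟩]
  · push_cast; ring
  · push_cast
    rw [norm_mul]
    exact mul_le_mul (hK n) (hL n) (norm_nonneg _) ((norm_nonneg _).trans (hK 0))

theorem inner_rdiag_symm (e : HilbertBasis ℕ ℂ H) {ρ : ℕ → ℝ}
    (hρ : BddSeq fun n => (ρ n : ℂ)) (x y : H) :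
    ⟪rdiag e ρ x, y⟫_ℂ = ⟪x, rdiag e ρ y⟫_ℂ := by
  refine (e.hasSum_inner_mul_inner _ y).unique ?_
  convert e.hasSum_inner_mul_inner x (rdiag e ρ y) using 2 with n
  rw [← inner_conj_symm _ (e n), rdiag, inner_diag e hρ, inner_diag e hρ,
    ← inner_conj_symm x (e n)]
  simp; ring

theorem inner_rdiag_self (e : HilbertBasis ℕ ℂ H) {ρ : ℕ → ℝ}
    (hρ : BddSeq fun n => (ρ n : ℂ)) (x : H) :
    HasSum (fun n => ‖⟪e n, x⟫_ℂ‖ ^ 2 * ρ n) (⟪x, rdiag e ρ x⟫_ℂ).re := by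
  have h := (e.hasSum_inner_mul_inner x (rdiag e ρ x)).mapL Complex.reCLM
  refine (funext fun n => ?_ : (fun n => ‖⟪e n, x⟫_ℂ‖ ^ 2 * ρ n) = _) ▸ h
  rw [rdiag, inner_diag e hρ, mul_left_comm, ← inner_conj_symm x (e n), Complex.conj_mul']
  simp [← Complex.ofReal_pow]; ring

theorem rdiag_nonneg (e : HilbertBasis ℕ ℂ H) {ρ : ℕ → ℝ}
    (hρ : BddSeq fun n => (ρ n : ℂ)) (h0 : ∀ n, 0 ≤ ρ n) : 0 ≤ rdiag e ρ := by
  rw [ContinuousLinearMap.nonneg_iff_isPositive]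
  refine ⟨fun x y => inner_rdiag_symm e hρ x y, fun x => ?_⟩
  rw [ContinuousLinearMap.reApplyInnerSelf_apply, inner_rdiag_symm e hρ]
  exact (inner_rdiag_self e hρ x).nonneg fun n => mul_nonneg (by positivity) (h0 n)

variable [CompleteSpace H]

theorem abs_rdiag (e : HilbertBasis ℕ ℂ H) {ρ : ℕ → ℝ}
    (hρ : BddSeq fun n => (ρ n : ℂ)) (h0 : ∀ n, 0 ≤ ρ n) :
    CFC.abs (rdiag e ρ) = rdiag e ρ :=
  CFC.abs_of_nonneg _ (rdiag_nonneg e hρ h0)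

theorem isTraceClass_rdiag (e : HilbertBasis ℕ ℂ H) {ρ : ℕ → ℝ} (h0 : ∀ n, 0 ≤ ρ n)
    (hs : Summable ρ) : IsTraceClass e (rdiag e ρ) := by
  have hρ : BddSeq fun n => (ρ n : ℂ) :=
    BddSeq.ofReal (K := ∑' n, ρ n) fun n => by
      rw [abs_of_nonneg (h0 n)]
      exact hs.le_tsum n fun j _ => h0 j
  rw [IsTraceClass, abs_rdiag e hρ h0]
  refine hs.congr fun n => ?_
  simp only [entry, rdiag, inner_diag e hρ, inner_basis]
  simp

/-! ### Compactness and singular numbers of diagonal operators -/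

/-- A norm limit of finite-rank truncations: the tail from `N` on has norm at most `ξ N`. -/
theorem isCompactOperator_rdiag (e : HilbertBasis ℕ ℂ H) {ξ : ℕ → ℝ} (hξ : IsNullDecr ξ) :
    IsCompactOperator (rdiag e ξ) := by
  set F : ℕ → H →L[ℂ] H := fun N => ∑ n ∈ Finset.range N,
    (ξ n : ℂ) • (ContinuousLinearMap.toSpanSingleton ℂ (e n) ∘L innerSL ℂ (e n)) with hF
  have hFi : ∀ N m x, ⟪e m, F N x⟫_ℂ = if m < N then (ξ m : ℂ) * ⟪e m, x⟫_ℂ else 0 := by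
    intro N m x
    have h : ∀ n, ⟪e m, ((ξ n : ℂ) •
        (ContinuousLinearMap.toSpanSingleton ℂ (e n) ∘L innerSL ℂ (e n))) x⟫_ℂ =
          if m = n then (ξ n : ℂ) * ⟪e n, x⟫_ℂ else 0 := fun n => by
      change ⟪e m, (ξ n : ℂ) • (⟪e n, x⟫_ℂ • e n)⟫_ℂ = _
      rw [inner_smul_right, inner_smul_right, inner_basis]
      split_ifs <;> simp
    simp only [hF, sum_apply, inner_sum, h]
    simp
  refine isCompactOperator_of_tendsto (F := F) (l := atTop) ?_ (Eventually.of_forall fun N => ?_)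
  · rw [tendsto_iff_norm_sub_tendsto_zero]
    refine squeeze_zero (fun _ => norm_nonneg _) (fun N => ?_) hξ.tendsto_zero
    have hb : ∀ n, ‖(if n < N then (0 : ℂ) else (ξ n : ℂ))‖ ≤ ξ N := fun n => by
      split_ifs with h
      · simpa using hξ.nonneg N
      · simpa [abs_of_nonneg (hξ.nonneg n)] using hξ.antitone (not_lt.1 h)
    have : rdiag e ξ - F N = diag e fun n => if n < N then (0 : ℂ) else (ξ n : ℂ) := by
      refine op_ext e fun m x => ?_
      rw [inner_diag e ⟨_, hb⟩, sub_apply, inner_sub_right, hFi, rdiag,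
        inner_diag e hξ.bddSeq]
      split_ifs <;> simp
    rw [norm_sub_rev, this]
    exact norm_diag_le e hb
  · have : F N ∈ compactOperator (RingHom.id ℂ) H H := by
      refine Submodule.sum_mem _ fun n _ => Submodule.smul_mem _ _ ?_
      have h : IsCompactOperator (innerSL ℂ (e n)) :=
        (isCompactOperator_id : IsCompactOperator (id : ℂ → ℂ)).comp_clm (innerSL ℂ (e n))
      exact h.clm_comp (ContinuousLinearMap.toSpanSingleton ℂ (e n))
    exact this

theorem IsNullDecr.finite_level {ξ : ℕ → ℝ} (hξ : IsNullDecr ξ) {t : ℝ} (ht : 0 < t) :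
    {n | ξ n = t}.Finite := by
  obtain ⟨N, hN⟩ := eventually_atTop.1 (hξ.tendsto_zero.eventually (gt_mem_nhds ht))
  refine (Set.finite_lt_nat N).subset fun n hn => ?_
  by_contra h
  exact (hN n (not_lt.1 h)).ne hn

theorem isSNumbers_rdiag (e : HilbertBasis ℕ ℂ H) {ξ : ℕ → ℝ} (hξ : IsNullDecr ξ) :
    IsSNumbers (rdiag e ξ) ξ := by
  refine ⟨hξ, fun t ht => ?_⟩
  rw [abs_rdiag e hξ.bddSeq hξ.nonneg]
  have hfin := hξ.finite_level ht
  have : Fintype {n | ξ n = t} := hfin.fintype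
  have hspan : Module.End.eigenspace (rdiag e ξ : H →ₗ[ℂ] H) (t : ℂ) =
      Submodule.span ℂ (Set.range fun n : {n | ξ n = t} => e n) := by
    ext x
    rw [Module.End.mem_eigenspace_iff]
    constructor
    · intro hx
      have h0 : ∀ n ∉ hfin.toFinset, e.repr x n • e n = 0 := by
        intro n hn
        have hn' : ξ n ≠ t := by simpa using hn
        have h1 : (ξ n : ℂ) * ⟪e n, x⟫_ℂ = t * ⟪e n, x⟫_ℂ := by
          rw [← inner_diag e hξ.bddSeq n x, ← inner_smul_right]
          exact congrArg _ hx
        rw [e.repr_apply_apply]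
        rcases mul_eq_mul_right_iff.1 h1 with h | h
        · exact absurd (by exact_mod_cast h) hn'
        · rw [h, zero_smul]
      rw [(e.hasSum_repr x).unique (hasSum_sum_of_ne_finset_zero h0)]
      refine Submodule.sum_mem _ fun n hn => Submodule.smul_mem _ _ (Submodule.subset_span ?_)
      exact ⟨⟨n, by simpa using hn⟩, rfl⟩
    · intro hx
      rw [← Module.End.mem_eigenspace_iff]
      revert x
      rw [← SetLike.le_def, Submodule.span_le]
      rintro _ ⟨⟨n, hn⟩, rfl⟩
      rw [SetLike.mem_coe, Module.End.mem_eigenspace_iff]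
      obtain ⟨K, hK⟩ := hξ.bddSeq
      change diag e _ (e n) = _
      rw [diag_apply_basis e _ K hK, show ξ n = t from hn]
  have hli : LinearIndependent ℂ fun n : {n | ξ n = t} => e n :=
    (e.orthonormal.comp _ Subtype.val_injective).linearIndependent
  rw [hspan, finrank_span_eq_card hli, Set.ncard_eq_toFinset_card', Set.toFinset_card]

/-! ### Operators between orthonormal families -/

/-- The partial isometry `J' J*`, where `J` and `J'` embed the `ℓ²` space of the index set along `v`
and `w`. -/
theorem exists_op_of_orthonormal {ι : Type*} {v w : ι → H} (hv : Orthonormal ℂ v)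
    (hw : Orthonormal ℂ w) :
    ∃ B : H →L[ℂ] H, (∀ i, B (v i) = w i) ∧ ∀ x, (∀ i, ⟪v i, x⟫_ℂ = 0) → B x = 0 := by
  classical
  set J := hv.orthogonalFamily.linearIsometry with hJ
  set J' := hw.orthogonalFamily.linearIsometry with hJ'
  have h1 : ∀ i, J (lp.single 2 i 1) = v i := fun i => by
    rw [hJ, OrthogonalFamily.linearIsometry_apply_single]; simp
  have h1' : ∀ i, J' (lp.single 2 i 1) = w i := fun i => by
    rw [hJ', OrthogonalFamily.linearIsometry_apply_single]; simp
  have h2 : ∀ y i, ((ContinuousLinearMap.adjoint J.toContinuousLinearMap) y : ι → ℂ) i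
      = ⟪v i, y⟫_ℂ := by
    intro y i
    rw [← h1 i]
    have := ContinuousLinearMap.adjoint_inner_right J.toContinuousLinearMap
      (lp.single 2 i (1 : ℂ)) y
    rw [lp.inner_single_left] at this
    simpa using this
  refine ⟨J'.toContinuousLinearMap ∘L ContinuousLinearMap.adjoint J.toContinuousLinearMap,
    fun i => ?_, fun x hx => ?_⟩
  · rw [← h1' i]
    change J' _ = J' _
    congr 1
    ext j
    refine (h2 _ _).trans ?_
    rw [orthonormal_iff_ite.1 hv]
    rcases eq_or_ne j i with rfl | h
    · simp
    · simp [h]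
  · change J' _ = 0
    rw [map_eq_zero_iff _ J'.injective]
    ext j
    exact (h2 _ _).trans (hx j)

end

section

variable {H : Type*} [NormedAddCommGroup H] [InnerProductSpace ℂ H]

/-! ### The characteristic set in terms of diagonal operators -/

theorem exists_orthonormal_of_finrank_eq {V : Submodule ℂ H} {s : Set ℕ} (hs : s.Finite)
    (hne : s.Nonempty) (h : s.ncard = Module.finrank ℂ V) :
    ∃ b : ℕ → H, (∀ n ∈ s, b n ∈ V) ∧
      ∀ n ∈ s, ∀ m ∈ s, ⟪b n, b m⟫_ℂ = if n = m then 1 else 0 := by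
  classical
  have : Fintype s := hs.fintype
  -- `finrank` is `0` in infinite dimension; nonemptiness of `s` makes it positive, so `V` really is
  -- finite dimensional.
  have hpos : 0 < Module.finrank ℂ V := by
    rw [← h]; exact (Set.ncard_pos hs).2 hne
  have : FiniteDimensional ℂ V := Module.finite_of_finrank_pos hpos
  have hcard : Fintype.card (Fin (Module.finrank ℂ V)) = Fintype.card s := by
    rw [Fintype.card_fin, ← h, Set.ncard_eq_toFinset_card', Set.toFinset_card]
  let b := (stdOrthonormalBasis ℂ V).reindex (Fintype.equivOfCardEq hcard)
  refine ⟨fun n => if hn : n ∈ s then (b ⟨n, hn⟩ : H) else 0, fun n hn => ?_,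
    fun n hn m hm => ?_⟩
  · simp [hn]
  · simp only [hn, hm, dite_true]
    rw [← Submodule.coe_inner, orthonormal_iff_ite.1 b.orthonormal]
    simp

theorem eigenspace_inner_eq_zero {T : H →L[ℂ] H} (hT : 0 ≤ T) {s t : ℝ} (hst : s ≠ t) {x y : H}
    (hx : T x = (s : ℂ) • x) (hy : T y = (t : ℂ) • y) : ⟪x, y⟫_ℂ = 0 := by
  rw [ContinuousLinearMap.nonneg_iff_isPositive] at hT
  have h : ⟪T x, y⟫_ℂ = ⟪x, T y⟫_ℂ := hT.1 x y
  rw [hx, hy, inner_smul_left, inner_smul_right, Complex.conj_ofReal] at h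
  rcases mul_eq_mul_right_iff.1 h with h | h
  · exact absurd (by exact_mod_cast h) hst
  · exact h

/-- Diagonal operators dominated by one in the ideal lie in the ideal. -/
theorem rdiag_mem_of_le (e : HilbertBasis ℕ ℂ H) {I : TwoSidedIdeal (H →L[ℂ] H)} {ρ σ : ℕ → ℝ}
    (hσ : BddSeq fun n => (σ n : ℂ)) (hI : rdiag e σ ∈ I) {M : ℝ}
    (h : ∀ n, |ρ n| ≤ M * σ n) (h0 : ∀ n, 0 ≤ σ n) : rdiag e ρ ∈ I := by
  have hM : ∀ n, |ρ n / σ n| ≤ max M 0 := fun n => by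
    rcases (h0 n).eq_or_lt with h1 | h1
    · simp [← h1]
    · rw [abs_div, abs_of_pos h1, div_le_iff₀ h1]
      exact (h n).trans (by gcongr; exact le_max_left _ _)
  -- Factor through the bounded quotient. Where `σ n = 0` the bound forces `ρ n = 0`, which agrees
  -- with the convention `x / 0 = 0`.
  have : rdiag e ρ = rdiag e (fun n => ρ n / σ n) * rdiag e σ := by
    rw [← rdiag_mul e (BddSeq.ofReal hM) hσ]
    congr 1
    ext n
    rcases (h0 n).eq_or_lt with h1 | h1
    · have := h n
      rw [← h1, mul_zero] at this
      rw [← h1, abs_nonpos_iff.1 this]; simp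
    · field_simp
  rw [this]
  exact I.mul_mem_left _ _ hI

variable [CompleteSpace H]

/-- The multiplicities provide orthonormal eigenvectors `f n` of `|X|` with eigenvalues `ξ n > 0`.
Since `‖X x‖ = ‖|X| x‖`, the vectors `g n = X (f n) / ξ n` are orthonormal as well. Now `B` sends `e
n` to `f n` and `A` sends `g n` to `e n`; neither the spectral theorem nor the polar decomposition
enters. -/
theorem IsSNumbers.exists_mul_mul_eq_rdiag (e : HilbertBasis ℕ ℂ H) {X : H →L[ℂ] H} {ξ : ℕ → ℝ}
    (h : IsSNumbers X ξ) : ∃ A B : H →L[ℂ] H, A * X * B = rdiag e ξ := by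
  classical
  obtain ⟨hξ, hX⟩ := h
  have hb : ∀ n, 0 < ξ n → ∃ b : ℕ → H,
      (∀ k ∈ {k | ξ k = ξ n}, b k ∈
        Module.End.eigenspace ((CFC.abs X : H →L[ℂ] H) : H →ₗ[ℂ] H) (ξ n : ℂ)) ∧
      ∀ k ∈ {k | ξ k = ξ n}, ∀ m ∈ {k | ξ k = ξ n}, ⟪b k, b m⟫_ℂ = if k = m then 1 else 0 :=
    fun n hn => exists_orthonormal_of_finrank_eq (hξ.finite_level hn) ⟨n, rfl⟩ (hX _ hn)
  have hb' : ∀ t, 0 < t → (∃ n, ξ n = t) → ∃ b : ℕ → H,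
      (∀ k, ξ k = t → (CFC.abs X : H →L[ℂ] H) (b k) = (t : ℂ) • b k) ∧
      ∀ k m, ξ k = t → ξ m = t → ⟪b k, b m⟫_ℂ = if k = m then 1 else 0 := by
    rintro t ht ⟨n, rfl⟩
    obtain ⟨b, h1, h2⟩ := hb n ht
    exact ⟨b, fun k hk => Module.End.mem_eigenspace_iff.1 (h1 k hk),
      fun k m hk hm => h2 k hk m hm⟩
  choose! b hb1 hb2 using hb'
  let ι := {n // 0 < ξ n}
  let f : ι → H := fun n => b (ξ n) n
  have hf1 : ∀ n : ι, (CFC.abs X : H →L[ℂ] H) (f n) = (ξ n : ℂ) • f n := fun n =>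
    hb1 _ n.2 ⟨n, rfl⟩ n rfl
  have hf : Orthonormal ℂ f := by
    rw [orthonormal_iff_ite]
    intro n m
    by_cases hnm : ξ n = ξ m
    · have := hb2 _ n.2 ⟨n, rfl⟩ n m rfl hnm.symm
      rcases eq_or_ne n m with rfl | h
      · simpa [f] using this
      · have h' : (n : ℕ) ≠ m := fun h' => h (Subtype.ext h')
        simpa [f, ← hnm, h, h'] using this
    · rw [eigenspace_inner_eq_zero (CFC.abs_nonneg X) hnm (hf1 n) (hf1 m), if_neg]
      rintro rfl
      exact hnm rfl
  have hsa : ∀ x y, ⟪(CFC.abs X : H →L[ℂ] H) x, y⟫_ℂ = ⟪x, (CFC.abs X : H →L[ℂ] H) y⟫_ℂ := by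
    have := CFC.abs_nonneg X
    rw [ContinuousLinearMap.nonneg_iff_isPositive] at this
    exact fun x y => this.1 x y
  have hXX : ∀ x y, ⟪X x, X y⟫_ℂ =
      ⟪(CFC.abs X : H →L[ℂ] H) x, (CFC.abs X : H →L[ℂ] H) y⟫_ℂ := by
    intro x y
    rw [hsa, ← mul_apply_eq_comp, CFC.abs_mul_abs, mul_apply_eq_comp,
      ContinuousLinearMap.star_eq_adjoint, ContinuousLinearMap.adjoint_inner_right]
  let g : ι → H := fun n => ((ξ n)⁻¹ : ℂ) • X (f n)
  have hξ0 : ∀ n : ι, (ξ n : ℂ) ≠ 0 := fun n => by exact_mod_cast n.2.ne'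
  have hg : Orthonormal ℂ g := by
    rw [orthonormal_iff_ite]
    intro n m
    simp only [g]
    rw [inner_smul_left, inner_smul_right, hXX, hf1, hf1, inner_smul_left, inner_smul_right,
      orthonormal_iff_ite.1 hf]
    have := hξ0 n
    split_ifs with h
    · subst h
      simp only [map_inv₀, Complex.conj_ofReal]
      field_simp
    · simp
  have he : Orthonormal ℂ fun n : ι => e n := e.orthonormal.comp _ Subtype.val_injective
  obtain ⟨A, hA, -⟩ := exists_op_of_orthonormal hg he
  obtain ⟨B, hB, hB0⟩ := exists_op_of_orthonormal he hf
  refine ⟨A, B, op_ext_basis e fun n => ?_⟩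
  obtain ⟨K, hK⟩ := hξ.bddSeq
  rw [rdiag, diag_apply_basis e _ K hK, mul_apply_eq_comp, mul_apply_eq_comp]
  rcases (hξ.nonneg n).eq_or_lt with h0 | hpos
  · rw [hB0, ← h0]
    · simp
    · rintro ⟨i, hi⟩
      rw [inner_basis, if_neg]
      rintro rfl
      exact hi.ne h0
  · have h1 := hB ⟨n, hpos⟩
    have h2 : X (f ⟨n, hpos⟩) = (ξ n : ℂ) • g ⟨n, hpos⟩ := by
      simp only [g]
      rw [smul_smul, mul_inv_cancel₀ (hξ0 ⟨n, hpos⟩), one_smul]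
    simp only at h1
    rw [h1, h2, map_smul, hA]

theorem mem_charSet_iff (e : HilbertBasis ℕ ℂ H) (I : TwoSidedIdeal (H →L[ℂ] H)) {ξ : ℕ → ℝ} :
    ξ ∈ charSet I ↔ IsNullDecr ξ ∧ rdiag e ξ ∈ I := by
  constructor
  · rintro ⟨X, hX, -, h⟩
    obtain ⟨A, B, hAB⟩ := h.exists_mul_mul_eq_rdiag e
    exact ⟨h.1, hAB ▸ I.mul_mem_right _ _ (I.mul_mem_left _ _ hX)⟩
  · rintro ⟨h, hI⟩
    exact ⟨_, hI, isCompactOperator_rdiag e h, isSNumbers_rdiag e h⟩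

theorem charSet_of_le (e : HilbertBasis ℕ ℂ H) {I : TwoSidedIdeal (H →L[ℂ] H)} {ξ η : ℕ → ℝ}
    (hη : η ∈ charSet I) (hξ : IsNullDecr ξ) {M : ℝ} (h : ∀ n, ξ n ≤ M * η n) :
    ξ ∈ charSet I := by
  rw [mem_charSet_iff e] at hη ⊢
  refine ⟨hξ, rdiag_mem_of_le e hη.1.bddSeq hη.2 (M := M) (fun n => ?_) hη.1.nonneg⟩
  rw [abs_of_nonneg (hξ.nonneg n)]
  exact h n

theorem IsNullDecr.add {ξ η : ℕ → ℝ} (hξ : IsNullDecr ξ) (hη : IsNullDecr η) :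
    IsNullDecr fun n => ξ n + η n :=
  ⟨fun n => add_nonneg (hξ.nonneg n) (hη.nonneg n), hξ.antitone.add hη.antitone,
    by simpa using hξ.tendsto_zero.add hη.tendsto_zero⟩

theorem IsNullDecr.const_mul {ξ : ℕ → ℝ} (hξ : IsNullDecr ξ) {M : ℝ} (hM : 0 ≤ M) :
    IsNullDecr fun n => M * ξ n :=
  ⟨fun n => mul_nonneg hM (hξ.nonneg n), hξ.antitone.const_mul hM,
    by simpa using hξ.tendsto_zero.const_mul M⟩

theorem IsNullDecr.double {ξ : ℕ → ℝ} (hξ : IsNullDecr ξ) : IsNullDecr fun n => ξ (n / 2) :=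
  ⟨fun _ => hξ.nonneg _, fun _ _ h => hξ.antitone (Nat.div_le_div_right h),
    hξ.tendsto_zero.comp (Nat.tendsto_div_const_atTop two_ne_zero)⟩

theorem charSet_add (e : HilbertBasis ℕ ℂ H) {I : TwoSidedIdeal (H →L[ℂ] H)} {ξ η : ℕ → ℝ}
    (hξ : ξ ∈ charSet I) (hη : η ∈ charSet I) : (fun n => ξ n + η n) ∈ charSet I := by
  rw [mem_charSet_iff e] at hξ hη ⊢
  refine ⟨hξ.1.add hη.1, ?_⟩
  rw [rdiag_add e hξ.1.bddSeq hη.1.bddSeq]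
  exact I.add_mem hξ.2 hη.2

end

section

variable {H : Type*} [NormedAddCommGroup H] [InnerProductSpace ℂ H]

/-! ### Ideals generated by diagonal operators -/

/-- Sets of sequences closed under sums, two-fold repetition of entries, and domination. -/
structure IsCharacteristic (S : Set (ℕ → ℝ)) : Prop where
  nullDecr : ∀ ξ ∈ S, IsNullDecr ξ
  zero_mem : (fun _ => 0) ∈ S
  add_mem : ∀ ξ ∈ S, ∀ η ∈ S, (fun n => ξ n + η n) ∈ S
  double_mem : ∀ ξ ∈ S, (fun n => ξ (n / 2)) ∈ S
  of_le : ∀ ξ ∈ S, ∀ η, IsNullDecr η → ∀ M : ℝ, (∀ n, η n ≤ M * ξ n) → η ∈ S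

/-- `X` is bounded by `s n` on the common kernel of `n` functionals, for every `n`. -/
def GelfandLE (X : H →L[ℂ] H) (s : ℕ → ℝ) : Prop :=
  ∀ n, ∃ φ : ℕ → H →ₗ[ℂ] ℂ, ∀ x, (∀ i < n, φ i x = 0) → ‖X x‖ ≤ s n * ‖x‖

/-- The `n` available functionals are shared: even places serve `X`, odd places serve `Y`. This is
why characteristic sets must be closed under doubling. -/
theorem GelfandLE.add {X Y : H →L[ℂ] H} {s t : ℕ → ℝ} (hX : GelfandLE X s) (hY : GelfandLE Y t) :
    GelfandLE (X + Y) fun n => s (n / 2) + t (n / 2) := by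
  intro n
  obtain ⟨φ, hφ⟩ := hX (n / 2)
  obtain ⟨ψ, hψ⟩ := hY (n / 2)
  refine ⟨fun i => if i % 2 = 0 then φ (i / 2) else ψ (i / 2), fun x hx => ?_⟩
  have h1 := hφ x fun i hi => by simpa using hx (2 * i) (by omega)
  have h2 := hψ x fun i hi => by
    have := hx (2 * i + 1) (by omega)
    beta_reduce at this
    rwa [if_neg (by omega), show (2 * i + 1) / 2 = i by omega] at this
  rw [add_apply, add_mul]
  exact (norm_add_le _ _).trans (add_le_add h1 h2)

theorem GelfandLE.mul_left {X : H →L[ℂ] H} {s : ℕ → ℝ} (hX : GelfandLE X s) (A : H →L[ℂ] H) :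
    GelfandLE (A * X) fun n => ‖A‖ * s n := by
  intro n
  obtain ⟨φ, hφ⟩ := hX n
  refine ⟨φ, fun x hx => ?_⟩
  rw [mul_apply_eq_comp, mul_assoc]
  exact (A.le_opNorm _).trans (by gcongr; exact hφ x hx)

theorem GelfandLE.mul_right {X : H →L[ℂ] H} {s : ℕ → ℝ} (hX : GelfandLE X s)
    (hs : ∀ n, 0 ≤ s n) (B : H →L[ℂ] H) : GelfandLE (X * B) fun n => ‖B‖ * s n := by
  intro n
  obtain ⟨φ, hφ⟩ := hX n
  refine ⟨fun i => φ i ∘ₗ (B : H →ₗ[ℂ] H), fun x hx => ?_⟩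
  beta_reduce
  rw [mul_apply_eq_comp, mul_comm ‖B‖, mul_assoc]
  refine (hφ (B x) fun i hi => hx i hi).trans ?_
  gcongr
  · exact hs n
  · exact B.le_opNorm x

theorem gelfandLE_rdiag (e : HilbertBasis ℕ ℂ H) {ξ : ℕ → ℝ} (hξ : IsNullDecr ξ) :
    GelfandLE (rdiag e ξ) ξ := by
  intro n
  refine ⟨fun i => (innerSL ℂ (e i) : H →ₗ[ℂ] ℂ), fun x hx => ?_⟩
  refine le_of_sq_le_sq ?_ (mul_nonneg (hξ.nonneg n) (norm_nonneg _))
  rw [mul_pow]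
  refine hasSum_le (fun m => ?_) (hasSum_sq_norm_inner e _)
    ((hasSum_sq_norm_inner e x).mul_left _)
  rw [rdiag, inner_diag e hξ.bddSeq, norm_mul, mul_pow]
  rcases lt_or_ge m n with h | h
  · have : ⟪e m, x⟫_ℂ = 0 := hx m h
    simp [this]
  · have h1 := hξ.nonneg m
    have h2 := hξ.antitone h
    gcongr
    simpa [abs_of_nonneg h1] using h2

/-- By dimension, `n` functionals have a common nonzero zero in the span of `e 0, …, e n`, and there
`diag ξ` stretches norms by at least `ξ n`. -/
theorem GelfandLE.le_of_rdiag (e : HilbertBasis ℕ ℂ H) {ξ s : ℕ → ℝ} (hξ : IsNullDecr ξ)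
    (h : GelfandLE (rdiag e ξ) s) (n : ℕ) : ξ n ≤ s n := by
  obtain ⟨φ, hφ⟩ := h n
  let V : (Fin (n + 1) → ℂ) →ₗ[ℂ] H := Fintype.linearCombination ℂ fun j : Fin (n + 1) => e j
  have hVi : ∀ c m, ⟪e m, V c⟫_ℂ = if hm : m < n + 1 then c ⟨m, hm⟩ else 0 := by
    intro c m
    simp only [V, Fintype.linearCombination_apply, inner_sum, inner_smul_right, inner_basis]
    split_ifs with hm
    · rw [Finset.sum_eq_single ⟨m, hm⟩]
      · simp
      · intro b _ hb
        rw [if_neg, mul_zero]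
        rintro rfl
        exact hb rfl
      · simp
    · refine Finset.sum_eq_zero fun i _ => ?_
      rw [if_neg, mul_zero]
      rintro rfl
      exact hm i.2
  let K : (Fin (n + 1) → ℂ) →ₗ[ℂ] (Fin n → ℂ) := LinearMap.pi fun i => φ i ∘ₗ V
  have hK : K.ker ≠ ⊥ := LinearMap.ker_ne_bot_of_finrank_lt (by simp)
  obtain ⟨c, hc, hc0⟩ := Submodule.exists_mem_ne_zero_of_ne_bot hK
  have hv := hφ (V c) fun i hi => congrFun (LinearMap.mem_ker.1 hc) ⟨i, hi⟩
  have hV0 : 0 < ‖V c‖ := by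
    rw [norm_pos_iff]
    intro h0
    apply hc0
    ext j
    have := hVi c j
    rw [h0, inner_zero_right, dif_pos j.2] at this
    exact this.symm
  have hlow : ξ n * ‖V c‖ ≤ ‖rdiag e ξ (V c)‖ := by
    refine le_of_sq_le_sq ?_ (norm_nonneg _)
    rw [mul_pow]
    refine hasSum_le (fun m => ?_) ((hasSum_sq_norm_inner e (V c)).mul_left _)
      (hasSum_sq_norm_inner e _)
    rw [rdiag, inner_diag e hξ.bddSeq, norm_mul, mul_pow]
    by_cases hm : m < n + 1
    · have h1 := hξ.nonneg n
      have h2 := hξ.antitone (Nat.lt_succ_iff.1 hm)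
      gcongr
      simpa [abs_of_nonneg (hξ.nonneg m)] using h2
    · simp [hVi, hm]
  exact le_of_mul_le_mul_right (hlow.trans hv) hV0

/-- The operators with a Gelfand bound from `S` form a two-sided ideal `J` containing the
generators, hence containing `idealOf e S`; for a diagonal operator, membership in `J` gives back
domination by an element of `S`. -/
theorem rdiag_mem_idealOf_iff (e : HilbertBasis ℕ ℂ H) {S : Set (ℕ → ℝ)}
    (hS : IsCharacteristic S) {ξ : ℕ → ℝ} (hξ : IsNullDecr ξ) :
    rdiag e ξ ∈ idealOf e S ↔ ξ ∈ S := by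
  refine ⟨fun h => ?_, fun h => TwoSidedIdeal.subset_span ⟨ξ, h, rfl⟩⟩
  have hmul : ∀ s ∈ S, ∀ M : ℝ, 0 ≤ M → (fun n => M * s n) ∈ S := fun s hs M hM =>
    hS.of_le s hs _ ((hS.nullDecr s hs).const_mul hM) M fun n => le_rfl
  let J : TwoSidedIdeal (H →L[ℂ] H) := .mk' {X | ∃ s ∈ S, GelfandLE X s}
    ⟨_, hS.zero_mem, fun n => ⟨0, fun x _ => by simp⟩⟩
    (fun {X Y} => by
      rintro ⟨s, hs, hX⟩ ⟨t, ht, hY⟩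
      exact ⟨_, hS.add_mem _ (hS.double_mem _ hs) _ (hS.double_mem _ ht), hX.add hY⟩)
    (fun {X} => by
      rintro ⟨s, hs, hX⟩
      exact ⟨s, hs, fun n => by simpa using hX n⟩)
    (fun {X Y} => by
      rintro ⟨s, hs, hX⟩
      exact ⟨_, hmul s hs _ (norm_nonneg _), hX.mul_left X⟩)
    (fun {X Y} => by
      rintro ⟨s, hs, hX⟩
      exact ⟨_, hmul s hs _ (norm_nonneg _), hX.mul_right (hS.nullDecr s hs).nonneg Y⟩)
  have hle : idealOf e S ≤ J := by
    rw [idealOf, TwoSidedIdeal.span_le]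
    rintro _ ⟨s, hs, rfl⟩
    rw [SetLike.mem_coe, TwoSidedIdeal.mem_mk']
    exact ⟨s, hs, gelfandLE_rdiag e (hS.nullDecr s hs)⟩
  have := hle h
  rw [TwoSidedIdeal.mem_mk'] at this
  obtain ⟨s, hs, hξs⟩ := this
  exact hS.of_le s hs ξ hξ 1 fun n => by simpa using hξs.le_of_rdiag e hξ n

theorem mem_charSet_idealOf_iff [CompleteSpace H] (e : HilbertBasis ℕ ℂ H) {S : Set (ℕ → ℝ)}
    (hS : IsCharacteristic S) {ξ : ℕ → ℝ} :
    ξ ∈ charSet (idealOf e S) ↔ ξ ∈ S := by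
  rw [mem_charSet_iff e]
  constructor
  · rintro ⟨h, hI⟩
    exact (rdiag_mem_idealOf_iff e hS h).1 hI
  · intro h
    have := hS.nullDecr _ h
    exact ⟨this, (rdiag_mem_idealOf_iff e hS this).2 h⟩

/-! ### Arithmetic means -/

theorem arithSeq_add (ξ η : ℕ → ℝ) (n : ℕ) :
    arithSeq (fun n => ξ n + η n) n = arithSeq ξ n + arithSeq η n := by
  simp only [arithSeq, Finset.sum_add_distrib, add_div]

theorem arithSeq_const_mul (M : ℝ) (ξ : ℕ → ℝ) (n : ℕ) :
    arithSeq (fun n => M * ξ n) n = M * arithSeq ξ n := by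
  simp only [arithSeq, ← Finset.mul_sum, mul_div_assoc]

theorem arithSeq_le_iff {ξ η : ℕ → ℝ} : (∀ n, arithSeq ξ n ≤ arithSeq η n) ↔ Majorized ξ η := by
  constructor
  · intro h n
    rcases n with _ | n
    · simp
    · have := h n
      rwa [arithSeq, arithSeq, div_le_div_iff_of_pos_right (by positivity)] at this
  · intro h n
    rw [arithSeq, arithSeq, div_le_div_iff_of_pos_right (by positivity)]
    exact h (n + 1)

theorem IsNullDecr.arithSeq {ξ : ℕ → ℝ} (hξ : IsNullDecr ξ) : IsNullDecr (arithSeq ξ) := by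
  refine ⟨fun n => div_nonneg (Finset.sum_nonneg fun _ _ => hξ.nonneg _) (by positivity),
    antitone_nat_of_succ_le fun n => ?_, ?_⟩
  · rw [AMClosure.arithSeq, AMClosure.arithSeq, div_le_div_iff₀ (by positivity) (by positivity),
      Finset.sum_range_succ]
    have h : ((n + 1 : ℕ) : ℝ) * ξ (n + 1) ≤ ∑ j ∈ Finset.range (n + 1), ξ j := by
      have := Finset.card_nsmul_le_sum (Finset.range (n + 1)) ξ (ξ (n + 1)) fun i hi =>
        hξ.antitone (Finset.mem_range.1 hi).le
      simpa using this
    push_cast at h ⊢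
    nlinarith
  · have h := hξ.tendsto_zero.cesaro
    have h2 := (tendsto_add_atTop_iff_nat 1).2 h
    refine h2.congr fun n => ?_
    rw [AMClosure.arithSeq]
    push_cast
    rw [inv_mul_eq_div]

theorem IsNullDecr.double_arithSeq_le {ξ : ℕ → ℝ} (hξ : IsNullDecr ξ) (n : ℕ) :
    AMClosure.arithSeq ξ (n / 2) ≤ 2 * AMClosure.arithSeq ξ n := by
  have h0 : 0 ≤ ∑ j ∈ Finset.range (n + 1), ξ j := Finset.sum_nonneg fun _ _ => hξ.nonneg _
  have h1 : ∑ j ∈ Finset.range (n / 2 + 1), ξ j ≤ ∑ j ∈ Finset.range (n + 1), ξ j :=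
    Finset.sum_le_sum_of_subset_of_nonneg
      (Finset.range_subset_range.2 (by omega)) fun _ _ _ => hξ.nonneg _
  have h2 : ((n : ℝ) + 1) ≤ 2 * (((n / 2 : ℕ) : ℝ) + 1) := by
    exact_mod_cast (by omega : n + 1 ≤ 2 * (n / 2 + 1))
  rw [AMClosure.arithSeq, AMClosure.arithSeq, ← mul_div_assoc,
    div_le_div_iff₀ (by positivity) (by positivity)]
  nlinarith

theorem IsNullDecr.double_majorized {ξ : ℕ → ℝ} (hξ : IsNullDecr ξ) :
    Majorized (fun n => ξ (n / 2)) fun n => 2 * ξ n := by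
  have h : ∀ m, ∑ j ∈ Finset.range (2 * m), ξ (j / 2) = ∑ j ∈ Finset.range m, 2 * ξ j := by
    intro m
    induction m with
    | zero => simp
    | succ m ih =>
      rw [show 2 * (m + 1) = 2 * m + 1 + 1 by ring, Finset.sum_range_succ, Finset.sum_range_succ,
        ih, Finset.sum_range_succ, show (2 * m) / 2 = m by omega,
        show (2 * m + 1) / 2 = m by omega]
      ring
  intro n
  calc ∑ j ∈ Finset.range n, ξ (j / 2) ≤ ∑ j ∈ Finset.range (2 * n), ξ (j / 2) :=
        Finset.sum_le_sum_of_subset_of_nonneg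
          (Finset.range_subset_range.2 (by omega)) fun _ _ _ => hξ.nonneg _
    _ = _ := h n

theorem isNullDecr_zero : IsNullDecr fun _ => 0 :=
  ⟨fun _ => le_rfl, antitone_const, tendsto_const_nhds⟩

variable [CompleteSpace H]

theorem zero_mem_charSet (e : HilbertBasis ℕ ℂ H) (I : TwoSidedIdeal (H →L[ℂ] H)) :
    (fun _ => 0) ∈ charSet I := by
  rw [mem_charSet_iff e]
  refine ⟨isNullDecr_zero, ?_⟩
  convert I.zero_mem
  refine op_ext e fun m x => ?_
  rw [rdiag, inner_diag e isNullDecr_zero.bddSeq]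
  simp

theorem charSet_isNullDecr {I : TwoSidedIdeal (H →L[ℂ] H)} {ξ : ℕ → ℝ} (h : ξ ∈ charSet I) :
    IsNullDecr ξ := by
  obtain ⟨X, -, -, hX⟩ := h
  exact hX.1

theorem charSet_const_mul (e : HilbertBasis ℕ ℂ H) {I : TwoSidedIdeal (H →L[ℂ] H)} {ξ : ℕ → ℝ}
    (h : ξ ∈ charSet I) {M : ℝ} (hM : 0 ≤ M) : (fun n => M * ξ n) ∈ charSet I :=
  charSet_of_le e h ((charSet_isNullDecr h).const_mul hM) (M := M) fun _ => le_rfl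

theorem isCharacteristic_arithMean (e : HilbertBasis ℕ ℂ H) (I : TwoSidedIdeal (H →L[ℂ] H)) :
    IsCharacteristic {ξ | IsNullDecr ξ ∧ ∃ η ∈ charSet I, ∃ M : ℝ, 0 < M ∧
      ∀ n, ξ n ≤ M * arithSeq η n} where
  nullDecr ξ h := h.1
  zero_mem := ⟨isNullDecr_zero, _, zero_mem_charSet e I, 1, one_pos, fun n => by
    simp [AMClosure.arithSeq]⟩
  add_mem := by
    rintro ξ ⟨hξ, η, hη, M, hM, h⟩ ξ' ⟨hξ', η', hη', M', hM', h'⟩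
    refine ⟨hξ.add hξ', _, charSet_add e (charSet_const_mul e hη hM.le)
      (charSet_const_mul e hη' hM'.le), 1, one_pos, fun n => ?_⟩
    rw [one_mul, arithSeq_add, arithSeq_const_mul, arithSeq_const_mul]
    exact add_le_add (h n) (h' n)
  double_mem := by
    rintro ξ ⟨hξ, η, hη, M, hM, h⟩
    refine ⟨hξ.double, η, hη, M * 2, by positivity, fun n => (h _).trans ?_⟩
    rw [mul_assoc]
    gcongr
    exact (charSet_isNullDecr hη).double_arithSeq_le n
  of_le := by
    rintro ξ ⟨hξ, η, hη, M, hM, h⟩ ζ hζ K hK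
    refine ⟨hζ, η, hη, (max K 0 + 1) * M, by positivity, fun n => (hK n).trans ?_⟩
    have h1 := (charSet_isNullDecr hη).arithSeq.nonneg n
    calc K * ξ n ≤ (max K 0 + 1) * ξ n := by
          gcongr
          · exact hξ.nonneg n
          · linarith [le_max_left K 0]
      _ ≤ (max K 0 + 1) * M * arithSeq η n := by
          rw [mul_assoc]; gcongr; exact h n

theorem isCharacteristic_preArithMean (e : HilbertBasis ℕ ℂ H)
    (I : TwoSidedIdeal (H →L[ℂ] H)) :
    IsCharacteristic {ξ | IsNullDecr ξ ∧ arithSeq ξ ∈ charSet I} where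
  nullDecr ξ h := h.1
  zero_mem := ⟨isNullDecr_zero, by
    convert zero_mem_charSet e I using 1
    ext n
    simp [AMClosure.arithSeq]⟩
  add_mem := by
    rintro ξ ⟨hξ, h⟩ η ⟨hη, h'⟩
    refine ⟨hξ.add hη, ?_⟩
    rw [show arithSeq (fun n => ξ n + η n) = _ from funext (arithSeq_add ξ η)]
    exact charSet_add e h h'
  double_mem := by
    rintro ξ ⟨hξ, h⟩
    refine ⟨hξ.double, charSet_of_le e h hξ.double.arithSeq (M := 2) fun n => ?_⟩
    rw [← arithSeq_const_mul]
    exact arithSeq_le_iff.2 hξ.double_majorized n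
  of_le := by
    rintro ξ ⟨hξ, h⟩ ζ hζ M hM
    refine ⟨hζ, charSet_of_le e h hζ.arithSeq (M := M) fun n => ?_⟩
    rw [← arithSeq_const_mul]
    exact arithSeq_le_iff.2 (fun n => Finset.sum_le_sum fun i _ => hM i) n

/-- The am-closure consists of the sequences majorized by elements of the ideal. -/
theorem mem_charSet_amClosure_iff (e : HilbertBasis ℕ ℂ H) (I : TwoSidedIdeal (H →L[ℂ] H))
    {ξ : ℕ → ℝ} (hξ : IsNullDecr ξ) :
    ξ ∈ charSet (amClosure e I) ↔ ∃ η ∈ charSet I, Majorized ξ η := by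
  rw [amClosure, preArithMean, mem_charSet_idealOf_iff e (isCharacteristic_preArithMean e _),
    Set.mem_ofPred_eq, arithMean, mem_charSet_idealOf_iff e (isCharacteristic_arithMean e I)]
  constructor
  · rintro ⟨-, -, η, hη, M, hM, h⟩
    -- The constant of `I_a` is absorbed into the majorant, which becomes `M η`.
    refine ⟨_, charSet_const_mul e hη hM.le, arithSeq_le_iff.1 fun n => ?_⟩
    rw [arithSeq_const_mul]
    exact h n
  · rintro ⟨η, hη, h⟩
    refine ⟨hξ, hξ.arithSeq, η, hη, 1, one_pos, fun n => ?_⟩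
    rw [one_mul]
    exact arithSeq_le_iff.2 h n

end

/-! ### Improving the majorant within the ideal -/

section

/-! ### Majorization of sequences -/

/-- With `c j` the sum of the first `n` entries of column `j`, one has `0 ≤ c j ≤ 1` and `∑ c j ≤
n`. Summing `c j * η j ≤ η n * c j + (η j - η n)⁺` over `j` gives the claim. -/
theorem IsSubstochastic.majorized {P : Matrix ℕ ℕ ℝ} (hP : IsSubstochastic P) {ξ η : ℕ → ℝ}
    (hη : IsNullDecr η) (h : IsImage ξ P η) : Majorized ξ η := by
  intro n
  have h1 : HasSum (fun j => (∑ i ∈ Finset.range n, P i j) * η j) (∑ i ∈ Finset.range n, ξ i) := by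
    simp only [Finset.sum_mul]
    exact hasSum_sum fun i _ => h i
  have h2 : HasSum (fun j => ∑ i ∈ Finset.range n, P i j)
      (∑ i ∈ Finset.range n, ∑' j, P i j) := hasSum_sum fun i _ => (hP.row_summable i).hasSum
  have h3 : ∑ i ∈ Finset.range n, ∑' j, P i j ≤ n := by
    simpa using Finset.sum_le_sum (s := Finset.range n) fun i _ => hP.row_le i
  have h4 : HasSum (fun j => if j < n then η j - η n else 0)
      (∑ j ∈ Finset.range n, (η j - η n)) := by
    have h5 := hasSum_sum_of_ne_finset_zero (f := fun j => if j < n then η j - η n else 0)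
      (s := Finset.range n) (L := .unconditional ℕ)
      fun j hj => if_neg (by simpa using hj)
    rwa [Finset.sum_congr rfl fun j hj => if_pos (Finset.mem_range.1 hj)] at h5
  have h6 := hasSum_le (fun j => ?_) h1 ((h2.mul_left (η n)).add h4)
  · rw [Finset.sum_sub_distrib] at h6
    simp only [Finset.sum_const, Finset.card_range, nsmul_eq_mul] at h6
    have := mul_le_mul_of_nonneg_left h3 (hη.nonneg n)
    linarith
  · have hc0 : 0 ≤ ∑ i ∈ Finset.range n, P i j := Finset.sum_nonneg fun i _ => hP.nonneg i j
    have hc1 : ∑ i ∈ Finset.range n, P i j ≤ 1 :=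
      ((hP.col_summable j).sum_le_tsum _ fun i _ => hP.nonneg i j).trans (hP.col_le j)
    split_ifs with hj
    · have := hη.antitone hj.le
      nlinarith
    · have := hη.antitone (not_lt.1 hj)
      nlinarith

theorem stronglyMajorized_iff {ξ η : ℕ → ℝ} : StronglyMajorized ξ η ↔
    Majorized ξ η ∧
      ∀ δ : ℝ, 0 < δ → ∃ᶠ n in atTop, ∑ j ∈ Finset.range n, (η j - ξ j) < δ := by
  refine and_congr_right fun hm => ?_
  have h0 : ∀ n, 0 ≤ ∑ j ∈ Finset.range n, (η j - ξ j) := fun n => by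
    rw [Finset.sum_sub_distrib]; exact sub_nonneg.2 (hm n)
  constructor
  · intro h δ hδ
    have h1 := frequently_lt_of_liminf_lt (b := ((δ : ℝ) : EReal)) (by isBoundedDefault)
      (h.trans_lt (by exact_mod_cast hδ))
    exact h1.mono fun n hn => by exact_mod_cast hn
  · intro h
    refine le_antisymm ?_ ?_
    · refine EReal.le_of_forall_lt_iff_le.1 fun δ hδ => ?_
      refine liminf_le_of_frequently_le' ((h δ (by exact_mod_cast hδ)).mono fun n hn => ?_)
      exact_mod_cast hn.le
    · exact le_liminf_of_le (by isBoundedDefault)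
        (Eventually.of_forall fun n => by exact_mod_cast h0 n)

/-- The decreasing sequences between `0` and `η` that majorize `ξ`. -/
def majorants (ξ η : ℕ → ℝ) : Set (ℕ → ℝ) :=
  {ζ | (∀ n, 0 ≤ ζ n ∧ ζ n ≤ η n) ∧ (∀ n, ζ (n + 1) ≤ ζ n) ∧ Majorized ξ ζ}

theorem isCompact_majorants (ξ η : ℕ → ℝ) : IsCompact (majorants ξ η) := by
  refine (isCompact_univ_pi fun n => isCompact_Icc (a := 0) (b := η n)).of_isClosed_subset ?_
    fun ζ h n _ => h.1 n
  have h1 : IsClosed {ζ : ℕ → ℝ | ∀ n, 0 ≤ ζ n ∧ ζ n ≤ η n} := by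
    simp only [Set.ofPred_forall]
    exact isClosed_iInter fun n => (isClosed_le continuous_const (continuous_apply n)).inter
      (isClosed_le (continuous_apply n) continuous_const)
  have h2 : IsClosed {ζ : ℕ → ℝ | ∀ n, ζ (n + 1) ≤ ζ n} := by
    simp only [Set.ofPred_forall]
    exact isClosed_iInter fun n => isClosed_le (continuous_apply _) (continuous_apply n)
  have h3 : IsClosed {ζ : ℕ → ℝ | Majorized ξ ζ} := by
    simp only [Majorized, Set.ofPred_forall]
    exact isClosed_iInter fun n => isClosed_le continuous_const
      (continuous_finsetSum _ fun j _ => continuous_apply j)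
  exact h1.inter (h2.inter h3)

/-- Minimize the continuous functional `∑ 2⁻ⁿ ζ n` over the compact set of majorants. It is strictly
increasing in each coordinate, so no single entry of a minimizer can be lowered. -/
theorem exists_minimal_majorant {ξ η : ℕ → ℝ} (hη : IsNullDecr η) (h : Majorized ξ η) :
    ∃ ζ ∈ majorants ξ η, ∀ n δ, 0 < δ → Function.update ζ n (ζ n - δ) ∉ majorants ξ η := by
  have hg : Summable fun n : ℕ => (1 / 2 : ℝ) ^ n * η 0 := summable_geometric_two.mul_right _
  have hb : ∀ n, ∀ ζ ∈ majorants ξ η, ‖(1 / 2 : ℝ) ^ n * ζ n‖ ≤ (1 / 2 : ℝ) ^ n * η 0 := by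
    intro n ζ hζ
    rw [norm_mul, Real.norm_of_nonneg (hζ.1 n).1, Real.norm_of_nonneg (by positivity)]
    gcongr
    exact (hζ.1 n).2.trans (hη.le_zero_index n)
  have hc : ContinuousOn (fun ζ : ℕ → ℝ => ∑' n, (1 / 2 : ℝ) ^ n * ζ n) (majorants ξ η) :=
    continuousOn_tsum (fun n => (continuous_const.mul (continuous_apply n)).continuousOn) hg hb
  obtain ⟨ζ, hζ, hmin⟩ := (isCompact_majorants ξ η).exists_isMinOn
    ⟨η, fun n => ⟨hη.nonneg n, le_rfl⟩, fun n => hη.antitone n.le_succ, h⟩ hc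
  refine ⟨ζ, hζ, fun n δ hδ hmem => ?_⟩
  refine not_lt_of_ge (show ∑' m, (1 / 2 : ℝ) ^ m * ζ m ≤
    ∑' m, (1 / 2 : ℝ) ^ m * Function.update ζ n (ζ n - δ) m from hmin hmem) ?_
  refine Summable.tsum_lt_tsum (i := n) (fun m => ?_) ?_
    (Summable.of_norm_bounded hg fun m => hb m _ hmem)
    (Summable.of_norm_bounded hg fun m => hb m _ hζ)
  · rcases eq_or_ne m n with rfl | hm
    · simp only [Function.update_self]; gcongr; linarith
    · simp [hm]
  · simp only [Function.update_self]; gcongr; linarith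

/-- If the defect `∑ (ζ - ξ)` of a minimal majorant stayed away from `0` beyond a strict descent of
`ζ`, the entry just before the descent could be lowered. -/
theorem exists_stronglyMajorized_le {ξ η : ℕ → ℝ} (hξ : IsNullDecr ξ) (hη : IsNullDecr η)
    (h : Majorized ξ η) :
    ∃ ζ, IsNullDecr ζ ∧ (∀ n, ζ n ≤ η n) ∧ StronglyMajorized ξ ζ := by
  obtain ⟨ζ, ⟨hζ1, hζ2, hζ3⟩, hmin⟩ := exists_minimal_majorant hη h
  have hζ : IsNullDecr ζ := ⟨fun n => (hζ1 n).1, antitone_nat_of_succ_le hζ2,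
    squeeze_zero (fun n => (hζ1 n).1) (fun n => (hζ1 n).2) hη.tendsto_zero⟩
  refine ⟨ζ, hζ, fun n => (hζ1 n).2, stronglyMajorized_iff.2 ⟨hζ3, ?_⟩⟩
  have key : ∀ n, ζ (n + 1) < ζ n → ∀ δ : ℝ, 0 < δ →
      ∃ m, n < m ∧ ∑ j ∈ Finset.range m, (ζ j - ξ j) < δ := by
    intro n hn δ hδ
    by_contra! hcon
    -- The bound by the jump keeps the lowered sequence decreasing and nonnegative; the bound by `δ`
    -- keeps it a majorant of `ξ`.
    set ε := min δ (ζ n - ζ (n + 1)) with hε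
    have hε0 : 0 < ε := lt_min hδ (sub_pos.2 hn)
    have hε1 : ε ≤ ζ n - ζ (n + 1) := min_le_right _ _
    have hle : ∀ m, Function.update ζ n (ζ n - ε) m ≤ ζ m := fun m => by
      rcases eq_or_ne m n with rfl | hm
      · simp [hε0.le]
      · simp [hm]
    refine hmin n ε hε0 ⟨fun m => ⟨?_, (hle m).trans (hζ1 m).2⟩, fun m => ?_, fun m => ?_⟩
    · rcases eq_or_ne m n with rfl | hm
      · rw [Function.update_self]; linarith [hζ.nonneg (m + 1)]
      · simpa [hm] using hζ.nonneg m
    · rcases eq_or_ne m n with rfl | hm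
      · rw [Function.update_self, Function.update_of_ne (by omega)]; linarith
      · rw [Function.update_of_ne hm]
        exact (hle _).trans (hζ2 m)
    · rcases le_or_gt m n with hm | hm
      · rw [Finset.sum_update_of_notMem (by simpa using hm)]
        exact hζ3 m
      · have h1 := hcon m hm
        have h2 : ∀ j, Function.update ζ n (ζ n - ε) j = ζ j - if j = n then ε else 0 :=
          fun j => by rcases eq_or_ne j n with rfl | hj <;> simp [*]
        have h3 : ε ≤ δ := min_le_left _ _
        simp only [h2, Finset.sum_sub_distrib, Finset.sum_ite_eq', Finset.mem_range, hm,
          if_true] at h1 ⊢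
        linarith
  intro δ hδ
  rw [frequently_atTop]
  intro N
  by_cases hN : ∃ n ≥ N, ζ (n + 1) < ζ n
  · obtain ⟨n, hn, hlt⟩ := hN
    obtain ⟨m, hm, hmδ⟩ := key n hlt δ hδ
    exact ⟨m, by omega, hmδ⟩
  -- With no descents beyond `N`, the limit forces `ζ = 0` there. The defect is then eventually
  -- nonincreasing, so a small value after the last descent persists.
  push Not at hN
  have hconst : ∀ k, ζ (N + k) = ζ N := by
    intro k
    induction k with
    | zero => rfl
    | succ k ih => rw [← ih]; exact le_antisymm (hζ2 _) (hN _ (by omega))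
  have hzero : ∀ n ≥ N, ζ n = 0 := by
    have : ζ N = 0 := by
      refine tendsto_nhds_unique (f := fun k => ζ (k + N)) (l := atTop) ?_
        ((tendsto_add_atTop_iff_nat N).2 hζ.tendsto_zero)
      simp only [add_comm _ N, hconst]
      exact tendsto_const_nhds
    intro n hn
    obtain ⟨k, rfl⟩ := Nat.exists_eq_add_of_le hn
    rw [hconst, this]
  by_cases hall : ζ 0 = 0
  · refine ⟨N, le_rfl, lt_of_le_of_lt (Finset.sum_nonpos fun j _ => ?_) hδ⟩
    have h1 := hζ.le_zero_index j
    have h2 := hξ.nonneg j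
    linarith
  · have hex : ∃ n, ζ n = 0 := ⟨N, hzero N le_rfl⟩
    classical
    obtain ⟨n, hn⟩ : ∃ n, Nat.find hex = n + 1 :=
      Nat.exists_eq_succ_of_ne_zero fun h0 => hall (by simpa [h0] using Nat.find_spec hex)
    have h1 : ζ (n + 1) = 0 := hn ▸ Nat.find_spec hex
    have h2 : ζ n ≠ 0 := Nat.find_min hex (by omega)
    obtain ⟨m, hm, hmδ⟩ := key n (by rw [h1]; exact lt_of_le_of_ne (hζ.nonneg n) h2.symm) δ hδ
    refine ⟨max m N, le_max_right _ _, lt_of_le_of_lt ?_ hmδ⟩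
    rw [← Finset.sum_range_add_sum_Ico _ (le_max_left m N), add_le_iff_nonpos_right]
    refine Finset.sum_nonpos fun j hj => ?_
    have h3 : ζ j ≤ ζ (n + 1) := hζ.antitone (by have := (Finset.mem_Ico.1 hj).1; omega)
    have h4 := hξ.nonneg j
    linarith

end

section

/-! ### Block majorization up to a summable perturbation -/

theorem Majorized.sum_sub_nonneg {ξ η : ℕ → ℝ} (h : Majorized ξ η) (n : ℕ) :
    0 ≤ ∑ j ∈ Finset.range n, (η j - ξ j) := by
  rw [Finset.sum_sub_distrib]; exact sub_nonneg.2 (h n)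

/-- The partial sums of a decreasing sequence lie below the tangent lines. -/
theorem sum_range_le_tangent {a : ℕ → ℝ} (ha : Antitone a) {p : ℕ} {s : ℝ} (h1 : a (p + 1) ≤ s)
    (h2 : s ≤ a p) (j : ℕ) :
    ∑ i ∈ Finset.range j, a i ≤ ∑ i ∈ Finset.range (p + 1), a i + s * (j - (p + 1 : ℕ)) := by
  rcases le_total (p + 1) j with h | h
  · obtain ⟨k, rfl⟩ := Nat.exists_eq_add_of_le h
    rw [Finset.sum_range_add, add_le_add_iff_left]
    have := Finset.sum_le_card_nsmul (Finset.range k) (fun i => a (p + 1 + i)) s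
      fun i _ => (ha (Nat.le_add_right _ _)).trans h1
    simp only [Finset.card_range, nsmul_eq_mul] at this
    push_cast at this ⊢
    linarith
  · obtain ⟨k, hk⟩ := Nat.exists_eq_add_of_le h
    rw [hk, Finset.sum_range_add]
    have := Finset.card_nsmul_le_sum (Finset.range k) (fun i => a (j + i)) s
      fun i hi => h2.trans (ha (by have := Finset.mem_range.1 hi; omega))
    simp only [Finset.card_range, nsmul_eq_mul] at this
    push_cast at this ⊢
    linarith

/-- If `ζ` exceeds `ξ` infinitely often and `d = ∑ (ζ - ξ)` has lower limit zero, then `d` has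
arbitrarily small local minima arbitrarily far out. -/
theorem exists_small_local_min {ξ ζ : ℕ → ℝ} (h : Majorized ξ ζ)
    (hsmall : ∀ δ : ℝ, 0 < δ → ∃ᶠ n in atTop, ∑ j ∈ Finset.range n, (ζ j - ξ j) < δ)
    (hinf : ∃ᶠ n in atTop, ξ n ≤ ζ n) {ε : ℝ} (hε : 0 < ε) :
    ∃ᶠ n in atTop, ∑ j ∈ Finset.range (n + 1), (ζ j - ξ j) < ε ∧ ζ n ≤ ξ n ∧
      ξ (n + 1) ≤ ζ (n + 1) := by
  set d : ℕ → ℝ := fun n => ∑ j ∈ Finset.range n, (ζ j - ξ j) with hd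
  have hd0 : ∀ n, 0 ≤ d n := h.sum_sub_nonneg
  have hds : ∀ n, d (n + 1) = d n + (ζ n - ξ n) := fun n => Finset.sum_range_succ _ _
  rw [frequently_atTop] at hinf ⊢
  intro N
  suffices ∃ n ≥ N, d (n + 1) < ε ∧ d (n + 1) ≤ d n ∧ d (n + 1) ≤ d (n + 2) by
    obtain ⟨n, hn, h1, h2, h3⟩ := this
    have h4 := hds n
    have h5 := hds (n + 1)
    exact ⟨n, hn, h1, by linarith, by linarith⟩
  by_cases hz : ∃ n ≥ N, d (n + 1) ≤ 0
  · obtain ⟨n, hn, h1⟩ := hz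
    exact ⟨n, hn, h1.trans_lt hε, h1.trans (hd0 _), h1.trans (hd0 _)⟩
  push Not at hz
  -- The minimum of `d` over `[N + 1, q + 1]` cannot be at the left end because `d p < d (N + 1)`.
  -- If it is at the right end, then `d q ≤ d (q + 1)` moves it to `q`.
  obtain ⟨p, hp, hpd⟩ := frequently_atTop.1 (hsmall _ (lt_min hε (hz N le_rfl))) (N + 2)
  obtain ⟨q, hq, hqd⟩ := hinf p
  obtain ⟨r, hr, hrmin⟩ := (Finset.Icc (N + 1) (q + 1)).exists_min_image d
    ⟨p, Finset.mem_Icc.2 ⟨by omega, by omega⟩⟩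
  rw [Finset.mem_Icc] at hr
  have hrp : d r ≤ d p := hrmin p (Finset.mem_Icc.2 ⟨by omega, by omega⟩)
  have hpε : d p < ε := lt_of_lt_of_le hpd (min_le_left _ _)
  have hpN : d p < d (N + 1) := lt_of_lt_of_le hpd (min_le_right _ _)
  have hrN : r ≠ N + 1 := by
    rintro rfl
    linarith
  have hq1 := hds q
  have aux : ∀ r', N + 1 < r' → r' ≤ q → d r' ≤ d r →
      ∃ n ≥ N, d (n + 1) < ε ∧ d (n + 1) ≤ d n ∧ d (n + 1) ≤ d (n + 2) := by
    intro r' h1 h2 h3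
    obtain ⟨n, rfl⟩ : ∃ n, r' = n + 1 := ⟨r' - 1, by omega⟩
    refine ⟨n, by omega, by linarith, h3.trans (hrmin n ?_), h3.trans (hrmin (n + 2) ?_)⟩ <;>
    · rw [Finset.mem_Icc]; omega
  rcases hr.2.eq_or_lt with rfl | hlt
  · exact aux q (by omega) le_rfl (by linarith)
  · exact aux r (by omega) (by omega) le_rfl

/-- Lowering `ζ` at local minima of `∑ (ζ - ξ)` by tangent lines produces a block majorant. -/
theorem exists_blockMajorized_of_local_min {ξ ζ : ℕ → ℝ} (hξ : IsNullDecr ξ) (hζ : IsNullDecr ζ)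
    (h : Majorized ξ ζ) {p : ℕ → ℕ} (hp : StrictMono p)
    (hp1 : ∀ k, ∑ j ∈ Finset.range (p k + 1), (ζ j - ξ j) < (1 / 2 : ℝ) ^ k)
    (hp2 : ∀ k, ζ (p k) ≤ ξ (p k)) (hp3 : ∀ k, ξ (p k + 1) ≤ ζ (p k + 1)) :
    ∃ η, IsNullDecr η ∧ BlockMajorized ξ η ∧ ∃ ρ : ℕ → ℝ, (∀ n, 0 ≤ ρ n) ∧ Summable ρ ∧
      ∀ n, η n ≤ ζ n + ρ n := by
  set X : ℕ → ℝ := fun n => ∑ j ∈ Finset.range n, ξ j with hX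
  set Z : ℕ → ℝ := fun n => ∑ j ∈ Finset.range n, ζ j with hZ
  have hZs : ∀ n, Z (n + 1) = Z n + ζ n := fun n => Finset.sum_range_succ _ _
  -- The slope lies between `ξ (p k + 1)` and `ξ (p k)`, so this line supports the concave `X` at `p
  -- k + 1`. It is also parallel to a supporting line of `Z` there, hence `Z` exceeds it by less
  -- than `(1 / 2) ^ k`.
  set l : ℕ → ℕ → ℝ := fun k j => X (p k + 1) + ζ (p k + 1) * (j - (p k + 1 : ℕ)) with hl
  have hls : ∀ k j, l k (j + 1) = l k j + ζ (p k + 1) := fun k j => by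
    simp only [hl]; push_cast; ring
  have hdec : ∀ n, ζ (n + 1) ≤ ζ n := fun n => hζ.antitone n.le_succ
  have hlX : ∀ k j, X j ≤ l k j := fun k j =>
    sum_range_le_tangent hξ.antitone (hp3 k) ((hdec _).trans (hp2 k)) j
  have hlZ : ∀ k j, Z j - l k j ≤ (1 / 2 : ℝ) ^ k := fun k j => by
    have h1 := sum_range_le_tangent hζ.antitone (le_refl (ζ (p k + 1))) (hdec (p k)) j
    have h2 := hp1 k
    rw [Finset.sum_sub_distrib] at h2
    simp only [hl, hX, hZ]
    linarith
  set u : ℕ → ℕ → ℝ := fun k j => max 0 (Z j - l k j) with hu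
  have hu0 : ∀ k j, 0 ≤ u k j := fun k j => le_max_left _ _
  have hu1 : ∀ k j, u k j ≤ (1 / 2 : ℝ) ^ k := fun k j => max_le (by positivity) (hlZ k j)
  have hup : ∀ k j, j < p k + 1 → u k j ≤ u k (j + 1) := fun k j hj => by
    have h1 := hls k j
    have h2 := hZs j
    have h3 : ζ (p k + 1) ≤ ζ j := hζ.antitone hj.le
    exact max_le_max le_rfl (by linarith)
  have hdown : ∀ k j, p k + 1 ≤ j → u k (j + 1) ≤ u k j := fun k j hj => by
    have h1 := hls k j
    have h2 := hZs j
    have h3 : ζ j ≤ ζ (p k + 1) := hζ.antitone hj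
    exact max_le_max le_rfl (by linarith)
  set f : ℕ → ℕ → ℝ := fun k j => min (Z j) (l k j) with hf
  have hfu : ∀ k j, f k j = Z j - u k j := fun k j => by
    simp only [hf, hu]
    rcases le_total (Z j) (l k j) with h | h
    · rw [min_eq_left h, max_eq_left (by linarith)]; ring
    · rw [min_eq_right h, max_eq_right (by linarith)]; ring
  have hfX : ∀ k j, X j ≤ f k j := fun k j => le_min (h j) (hlX k j)
  -- An infimum of concave functions lying above `X` and touching `X` at every `p k + 1`; the block
  -- majorant will be its increments.
  set g : ℕ → ℝ := fun j => ⨅ k, f k j with hg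
  have hbdd : ∀ j, BddBelow (Set.range fun k => f k j) := fun j =>
    ⟨X j, by rintro _ ⟨k, rfl⟩; exact hfX k j⟩
  have hgf : ∀ j k, g j ≤ f k j := fun j k => ciInf_le (hbdd j) k
  have hgX : ∀ j, X j ≤ g j := fun j => le_ciInf fun k => hfX k j
  have hg0 : g 0 = 0 := by
    refine le_antisymm ((hgf 0 0).trans ((min_le_left _ _).trans ?_)) ?_
    · simp [hZ]
    · have := hgX 0
      simpa [hX] using this
  have hgp : ∀ k, g (p k + 1) = X (p k + 1) := fun k => by
    refine le_antisymm ((hgf _ k).trans ((min_le_right _ _).trans ?_)) (hgX _)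
    simp [hl]
  have hmono : ∀ j, g j ≤ g (j + 1) := fun j => le_ciInf fun k => by
    refine (hgf j k).trans (min_le_min ?_ ?_)
    · rw [hZs]; linarith [hζ.nonneg j]
    · rw [hls]; linarith [hζ.nonneg (p k + 1)]
  have hconc : ∀ j, g (j + 2) + g j ≤ 2 * g (j + 1) := fun j => by
    have : (g (j + 2) + g j) / 2 ≤ g (j + 1) := le_ciInf fun k => by
      have h1 := hgf j k
      have h2 := hgf (j + 2) k
      have h3 := hls k j
      have h4 := hls k (j + 1)
      have h5 := hZs j
      have h6 := hZs (j + 1)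
      have h7 := hdec j
      have h8 : f k j ≤ Z j := min_le_left _ _
      have h9 : f k j ≤ l k j := min_le_right _ _
      have h10 : f k (j + 2) ≤ Z (j + 2) := min_le_left _ _
      have h11 : f k (j + 2) ≤ l k (j + 2) := min_le_right _ _
      refine le_min ?_ ?_ <;> linarith
    linarith
  -- Each `u k` rises up to `p k + 1` and falls afterwards. Only the falling part can make the
  -- increments of `f k = Z - u k` exceed `ζ`. Summed over `k`, these falls form a telescoping
  -- series with total at most `R 0`.
  set R : ℕ → ℝ := fun j => ∑' k, u k (max j (p k + 1)) with hR
  have hsum : ∀ j, Summable fun k => u k (max j (p k + 1)) := fun j =>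
    Summable.of_nonneg_of_le (fun k => hu0 _ _) (fun k => hu1 _ _) summable_geometric_two
  have hstep : ∀ k j, 0 ≤ u k (max j (p k + 1)) - u k (max (j + 1) (p k + 1)) := fun k j => by
    rcases lt_or_ge j (p k + 1) with hj | hj
    · rw [max_eq_right hj.le, max_eq_right hj, sub_self]
    · rw [max_eq_left hj, max_eq_left (by omega)]
      exact sub_nonneg.2 (hdown k j hj)
  have hρ : ∀ j, R j - R (j + 1) =
      ∑' k, (u k (max j (p k + 1)) - u k (max (j + 1) (p k + 1))) := fun j =>
    ((hsum j).tsum_sub (hsum (j + 1))).symm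
  have hρ0 : ∀ j, 0 ≤ R j - R (j + 1) := fun j => by
    rw [hρ]; exact tsum_nonneg fun k => hstep k j
  have hρs : Summable fun j => R j - R (j + 1) := by
    refine summable_of_sum_range_le (c := R 0) hρ0 fun n => ?_
    rw [Finset.sum_range_sub']
    exact sub_le_self _ (tsum_nonneg fun k => hu0 _ _)
  have hle : ∀ j, g (j + 1) - g j ≤ ζ j + (R j - R (j + 1)) := fun j => by
    have : g (j + 1) - (ζ j + (R j - R (j + 1))) ≤ g j := le_ciInf fun k => by
      have h1 := hgf (j + 1) k
      have h2 : u k (max j (p k + 1)) - u k (max (j + 1) (p k + 1)) ≤ R j - R (j + 1) := by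
        rw [hρ]
        exact ((hsum j).sub (hsum (j + 1))).le_tsum k fun i _ => hstep i j
      have h3 := hZs j
      rw [hfu] at h1
      rw [hfu]
      rcases lt_or_ge j (p k + 1) with hj | hj
      · have := hup k j hj
        have := hρ0 j
        linarith
      · rw [max_eq_left hj, max_eq_left (by omega)] at h2
        linarith
    linarith
  have hsumg : ∀ n, ∑ j ∈ Finset.range n, (g (j + 1) - g j) = g n := fun n => by
    rw [Finset.sum_range_sub, hg0, sub_zero]
  refine ⟨fun j => g (j + 1) - g j, ⟨fun j => sub_nonneg.2 (hmono j),
    antitone_nat_of_succ_le fun j => ?_, ?_⟩, ⟨fun n => ?_, fun k => p k + 1, ?_, fun k => ?_⟩,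
    fun j => R j - R (j + 1), hρ0, hρs, hle⟩
  · have := hconc j
    linarith
  · refine squeeze_zero (fun j => sub_nonneg.2 (hmono j)) hle ?_
    simpa using hζ.tendsto_zero.add hρs.tendsto_atTop_zero
  · rw [hsumg]; exact hgX n
  · exact fun a b hab => Nat.add_lt_add_right (hp hab) 1
  · rw [hsumg, hgp]

/-- If `ξ ≤ ζ` infinitely often, small local minima of the defect serve as block ends. Otherwise `ξ`
is its own block majorant: its eventual excess over `ζ` is summable because the defect stays
nonnegative. -/
theorem exists_blockMajorized_le_add_summable {ξ ζ : ℕ → ℝ} (hξ : IsNullDecr ξ)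
    (hζ : IsNullDecr ζ) (h : StronglyMajorized ξ ζ) :
    ∃ η, IsNullDecr η ∧ BlockMajorized ξ η ∧ ∃ ρ : ℕ → ℝ, (∀ n, 0 ≤ ρ n) ∧ Summable ρ ∧
      ∀ n, η n ≤ ζ n + ρ n := by
  obtain ⟨hm, hsmall⟩ := stronglyMajorized_iff.1 h
  by_cases hinf : ∃ᶠ n in atTop, ξ n ≤ ζ n
  · obtain ⟨p, hp, hP⟩ := extraction_forall_of_frequently fun k : ℕ =>
      exists_small_local_min hm hsmall hinf (ε := (1 / 2 : ℝ) ^ k) (by positivity)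
    exact exists_blockMajorized_of_local_min hξ hζ hm hp (fun k => (hP k).1)
      (fun k => (hP k).2.1) fun k => (hP k).2.2
  · rw [not_frequently, eventually_atTop] at hinf
    obtain ⟨N, hN⟩ := hinf
    push Not at hN
    refine ⟨ξ, hξ, ⟨fun _ => le_rfl, id, strictMono_id, fun _ => rfl⟩,
      fun n => max 0 (ξ n - ζ n), fun n => le_max_left _ _, ?_, fun n => ?_⟩
    · rw [← summable_nat_add_iff N]
      refine summable_of_sum_range_le (c := ∑ j ∈ Finset.range N, (ζ j - ξ j))
        (fun n => le_max_left _ _) fun n => ?_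
      have h1 := hm.sum_sub_nonneg (N + n)
      rw [Finset.sum_range_add] at h1
      have h2 : ∀ j, max 0 (ξ (j + N) - ζ (j + N)) = -(ζ (N + j) - ξ (N + j)) := fun j => by
        rw [max_eq_right (by linarith [hN (j + N) (by omega)]), add_comm j N]; ring
      simp only [h2, Finset.sum_neg_distrib]
      linarith
    · have := le_max_right 0 (ξ n - ζ n)
      linarith

end

/-! ### Construction of the orthogonal matrix by successive rotations -/

section

/-! ### One rotation step on sequences -/

/-- Replace the entries `x k, x (k + 1)` by the single entry `a`. -/
def merge {V : Type*} (k : ℕ) (a : V) (x : ℕ → V) (j : ℕ) : V :=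
  if j < k then x j else if j = k then a else x (j + 1)

theorem merge_of_lt {V : Type*} {k j : ℕ} (h : j < k) (a : V) (x : ℕ → V) :
    merge k a x j = x j := if_pos h

theorem merge_self {V : Type*} (k : ℕ) (a : V) (x : ℕ → V) : merge k a x k = a := by
  simp [merge]

theorem merge_of_gt {V : Type*} {k j : ℕ} (h : k < j) (a : V) (x : ℕ → V) :
    merge k a x j = x (j + 1) := by
  rw [merge, if_neg (by omega), if_neg (by omega)]

theorem sum_merge_of_le {k n : ℕ} (h : n ≤ k) (a : ℝ) (x : ℕ → ℝ) :
    ∑ j ∈ Finset.range n, merge k a x j = ∑ j ∈ Finset.range n, x j :=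
  Finset.sum_congr rfl fun j hj => merge_of_lt (by have := Finset.mem_range.1 hj; omega) a x

theorem sum_merge_of_lt {k n : ℕ} (h : k < n) (a : ℝ) (x : ℕ → ℝ) :
    ∑ j ∈ Finset.range n, merge k a x j =
      ∑ j ∈ Finset.range (n + 1), x j + (a - x k - x (k + 1)) := by
  induction n, h using Nat.le_induction with
  | base =>
    rw [Finset.sum_range_succ, sum_merge_of_le le_rfl, merge_self, Finset.sum_range_succ,
      Finset.sum_range_succ]
    ring
  | succ n hn ih =>
    rw [Finset.sum_range_succ, ih, merge_of_gt hn, Finset.sum_range_succ _ (n + 1)]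
    ring

theorem hasSum_merge {k : ℕ} {a S : ℝ} {x : ℕ → ℝ} (hx : ∀ j, 0 ≤ x j) (ha : a = x k + x (k + 1))
    (h : HasSum x S) : HasSum (merge k a x) S := by
  have h0 : ∀ j, 0 ≤ merge k a x j := fun j => by
    unfold merge
    split_ifs
    · exact hx j
    · rw [ha]; exact add_nonneg (hx _) (hx _)
    · exact hx _
  rw [hasSum_iff_tendsto_nat_of_nonneg h0]
  have h1 := (tendsto_add_atTop_iff_nat 1).2 h.tendsto_sum_nat
  refine h1.congr' ?_
  filter_upwards [eventually_gt_atTop k] with n hn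
  rw [sum_merge_of_lt hn, ha]
  ring

/-- The least `k` with `η (k + 1) ≤ t`. -/
def pivot (η : ℕ → ℝ) (t : ℝ) : ℕ := sInf {k | η (k + 1) ≤ t}

/-- The sequence obtained from `η` by splitting off the value `t`. -/
def splitOff (η : ℕ → ℝ) (t : ℝ) : ℕ → ℝ :=
  merge (pivot η t) (η (pivot η t) + η (pivot η t + 1) - t) η

theorem pivot_le {η : ℕ → ℝ} {t : ℝ} {k : ℕ} (h : η (k + 1) ≤ t) : pivot η t ≤ k :=
  Nat.sInf_le h

section step

variable {ξ η : ℕ → ℝ}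

/-- Ensures that the infimum in `pivot` is over a nonempty set. When `ξ 0 = 0`, convergence of `η`
is not enough: strong majorization is needed to force `η 1 = 0`. -/
theorem StronglyMajorized.exists_le (hξ : IsNullDecr ξ) (hη : IsNullDecr η)
    (h : StronglyMajorized ξ η) : ∃ k, η (k + 1) ≤ ξ 0 := by
  rcases (hξ.nonneg 0).eq_or_lt with h0 | h0
  · refine ⟨0, le_of_forall_pos_le_add fun δ hδ => ?_⟩
    obtain ⟨n, hn, hnδ⟩ := frequently_atTop.1 ((stronglyMajorized_iff.1 h).2 δ hδ) 2
    have h1 : ∀ j, η j - ξ j = η j := fun j => by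
      rw [le_antisymm ((hξ.le_zero_index j).trans h0.symm.le) (hξ.nonneg j), sub_zero]
    simp only [h1] at hnδ
    have h2 := Finset.single_le_sum (f := η) (fun j _ => hη.nonneg j)
      (Finset.mem_range.2 (by omega : 1 < n))
    rw [← h0, zero_add, zero_add]
    exact h2.trans hnδ.le
  · obtain ⟨k, hk⟩ := (((tendsto_add_atTop_iff_nat 1).2 hη.tendsto_zero).eventually
      (gt_mem_nhds h0)).exists
    exact ⟨k, hk.le⟩

theorem StronglyMajorized.pivot_succ_le (hξ : IsNullDecr ξ) (hη : IsNullDecr η)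
    (h : StronglyMajorized ξ η) : η (pivot η (ξ 0) + 1) ≤ ξ 0 :=
  Nat.sInf_mem (s := {k | η (k + 1) ≤ ξ 0}) (h.exists_le hξ hη)

theorem StronglyMajorized.zero_le (h : StronglyMajorized ξ η) : ξ 0 ≤ η 0 := by
  simpa using h.1 1

theorem StronglyMajorized.le_pivot (h : StronglyMajorized ξ η) : ξ 0 ≤ η (pivot η (ξ 0)) := by
  rcases Nat.eq_zero_or_pos (pivot η (ξ 0)) with h0 | h0
  · rw [h0]; exact h.zero_le
  · by_contra! hlt
    obtain ⟨k, hk⟩ := Nat.exists_eq_succ_of_ne_zero h0.ne'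
    rw [hk] at hlt
    have := pivot_le hlt.le
    omega

/-- Replacing two entries by their sum minus `ξ 0` preserves the defect, up to an index shift,
beyond the pivot. -/
theorem StronglyMajorized.sum_splitOff {n : ℕ} (hn : pivot η (ξ 0) < n) :
    ∑ j ∈ Finset.range n, (splitOff η (ξ 0) j - ξ (j + 1)) =
      ∑ j ∈ Finset.range (n + 1), (η j - ξ j) := by
  rw [Finset.sum_sub_distrib, Finset.sum_sub_distrib, splitOff, sum_merge_of_lt hn,
    Finset.sum_range_succ' ξ]
  ring

/-- At the pivot `η (k + 1) ≤ ξ 0 ≤ η k`, so the new entry `η k + η (k + 1) - ξ 0` also lies between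
these two and no reordering is required. -/
theorem StronglyMajorized.isNullDecr_splitOff (hξ : IsNullDecr ξ) (hη : IsNullDecr η)
    (h : StronglyMajorized ξ η) : IsNullDecr (splitOff η (ξ 0)) := by
  have h1 := h.pivot_succ_le hξ hη
  have h2 := h.le_pivot
  set k := pivot η (ξ 0) with hk
  have h3 : η (k + 1) ≤ η k := hη.antitone k.le_succ
  refine ⟨fun n => ?_, antitone_nat_of_succ_le fun n => ?_, ?_⟩
  · rw [splitOff, ← hk, merge]
    split_ifs
    · exact hη.nonneg n
    · linarith [hη.nonneg (k + 1)]
    · exact hη.nonneg _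
  · rw [splitOff, ← hk]
    rcases lt_trichotomy n k with hn | hn | hn
    · rw [merge_of_lt hn]
      rcases (Nat.succ_le_of_lt hn).eq_or_lt with hn' | hn'
      · rw [show n + 1 = k from hn', merge_self]
        linarith [hη.antitone hn.le]
      · rw [merge_of_lt hn']
        exact hη.antitone n.le_succ
    · rw [hn, merge_self, merge_of_gt (by omega)]
      linarith [hη.antitone (Nat.le_succ (k + 1))]
    · rw [merge_of_gt hn, merge_of_gt (by omega)]
      exact hη.antitone (by omega)
  · refine ((tendsto_add_atTop_iff_nat 1).2 hη.tendsto_zero).congr' ?_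
    filter_upwards [eventually_gt_atTop k] with n hn
    rw [splitOff, ← hk, merge_of_gt hn]

theorem StronglyMajorized.splitOff (hξ : IsNullDecr ξ) (hη : IsNullDecr η)
    (h : StronglyMajorized ξ η) :
    StronglyMajorized (fun j => ξ (j + 1)) (splitOff η (ξ 0)) := by
  have h2 := h.le_pivot
  rw [stronglyMajorized_iff] at h ⊢
  refine ⟨fun n => ?_, fun δ hδ => ?_⟩
  · rcases le_or_gt n (pivot η (ξ 0)) with hn | hn
    · rw [AMClosure.splitOff, sum_merge_of_le hn]
      refine Finset.sum_le_sum fun j hj => ?_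
      have h3 := hη.antitone ((Finset.mem_range.1 hj).le.trans hn)
      exact (hξ.le_zero_index _).trans (h2.trans h3)
    · have h3 := sum_splitOff hn (ξ := ξ)
      have h4 := h.1.sum_sub_nonneg (n + 1)
      rw [← h3, Finset.sum_sub_distrib] at h4
      linarith
  · rw [frequently_atTop]
    intro N
    obtain ⟨n, hn, hnδ⟩ := frequently_atTop.1 (h.2 δ hδ) (N + pivot η (ξ 0) + 2)
    obtain ⟨n, rfl⟩ : ∃ n', n = n' + 1 := ⟨n - 1, by omega⟩
    refine ⟨n, by omega, ?_⟩
    rwa [sum_splitOff (by omega)]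

/-- Up to the pivot, the difference of the partial sums is at least the first difference. -/
theorem StronglyMajorized.sub_le_sum (hξ : IsNullDecr ξ) (hη : IsNullDecr η)
    (h : StronglyMajorized ξ η) {n : ℕ} (hn : n ≤ pivot η (ξ 0)) :
    η 0 - ξ 0 ≤ ∑ j ∈ Finset.range (n + 1), (η j - ξ j) := by
  refine Finset.single_le_sum (f := fun j => η j - ξ j) (fun j hj => ?_)
    (Finset.mem_range.2 n.succ_pos)
  have h1 := h.le_pivot
  have h2 := hη.antitone ((Nat.lt_succ_iff.1 (Finset.mem_range.1 hj)).trans hn)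
  have h3 := hξ.le_zero_index j
  linarith

end step

/-! ### Iterating the rotation step -/

/-- The sequence that remains after splitting off `ξ 0, …, ξ (m - 1)` from `η`. -/
def remSeq (ξ η : ℕ → ℝ) : ℕ → ℕ → ℝ
  | 0 => η
  | m + 1 => splitOff (remSeq ξ η m) (ξ m)

theorem IsNullDecr.shift {ξ : ℕ → ℝ} (hξ : IsNullDecr ξ) (m : ℕ) : IsNullDecr fun j => ξ (m + j) :=
  ⟨fun _ => hξ.nonneg _, fun _ _ h => hξ.antitone (Nat.add_le_add_left h m), by
    simpa only [add_comm m] using (tendsto_add_atTop_iff_nat m).2 hξ.tendsto_zero⟩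

section iterate

variable {ξ η : ℕ → ℝ}

theorem remSeq_inv (hξ : IsNullDecr ξ) (hη : IsNullDecr η) (h : StronglyMajorized ξ η) (m : ℕ) :
    IsNullDecr (remSeq ξ η m) ∧ StronglyMajorized (fun j => ξ (m + j)) (remSeq ξ η m) := by
  induction m with
  | zero => exact ⟨hη, by simpa [remSeq] using h⟩
  | succ m ih =>
    have h1 := ih.2.isNullDecr_splitOff (hξ.shift m) ih.1
    have h2 := ih.2.splitOff (hξ.shift m) ih.1
    refine ⟨h1, ?_⟩
    simpa only [remSeq, add_zero, show ∀ j, m + 1 + j = m + (j + 1) by omega] using h2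

theorem remSeq_zero_antitone (hξ : IsNullDecr ξ) (hη : IsNullDecr η) (h : StronglyMajorized ξ η) :
    Antitone fun m => remSeq ξ η m 0 := by
  refine antitone_nat_of_succ_le fun m => ?_
  obtain ⟨h1, h2⟩ := remSeq_inv hξ hη h m
  have h3 := h2.pivot_succ_le (hξ.shift m) h1
  simp only [add_zero] at h3
  rw [remSeq, splitOff]
  rcases Nat.eq_zero_or_pos (pivot (remSeq ξ η m) (ξ m)) with h0 | h0
  · rw [h0] at h3 ⊢
    rw [merge_self]
    linarith
  · rw [merge_of_lt h0]

/-- Up to the pivot the first difference, at least `c / 2`, bounds the defect from below. Past the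
pivot the defect equals one with a shorter range in the next remainder, so induction applies. -/
theorem le_sum_remSeq (hξ : IsNullDecr ξ) (hη : IsNullDecr η) (h : StronglyMajorized ξ η) {c : ℝ}
    (hc : ∀ m, c ≤ remSeq ξ η m 0) {M : ℕ} (hM : ∀ m ≥ M, ξ m ≤ c / 2) (n : ℕ) :
    ∀ m ≥ M, c / 2 ≤ ∑ j ∈ Finset.range (n + 1), (remSeq ξ η m j - ξ (m + j)) := by
  induction n with
  | zero =>
    intro m hm
    have h1 := hc m
    have h2 := hM m hm
    rw [Finset.sum_range_one, add_zero]
    linarith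
  | succ n ih =>
    intro m hm
    obtain ⟨h1, h2⟩ := remSeq_inv hξ hη h m
    rcases le_or_gt (n + 1) (pivot (remSeq ξ η m) (ξ m)) with hn | hn
    · have h3 := h2.sub_le_sum (hξ.shift m) h1 (n := n + 1) (by simpa using hn)
      have h4 := hc m
      have h5 := hM m hm
      simp only [add_zero] at h3
      linarith
    · have h3 := StronglyMajorized.sum_splitOff (ξ := fun j => ξ (m + j)) (η := remSeq ξ η m)
        (n := n + 1) (by simpa using hn)
      rw [← h3]
      have h4 := ih (m + 1) (by omega)
      simpa only [remSeq, add_zero, show ∀ j, m + 1 + j = m + (j + 1) by omega] using h4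

/-- Otherwise the antitone heads stay above some `c > 0`, and once `ξ ≤ c / 2` the defect of a
remainder is bounded below, against strong majorization. -/
theorem remSeq_zero_tendsto (hξ : IsNullDecr ξ) (hη : IsNullDecr η) (h : StronglyMajorized ξ η) :
    Tendsto (fun m => remSeq ξ η m 0) atTop (𝓝 0) := by
  have h0 : ∀ m, 0 ≤ remSeq ξ η m 0 := fun m => (remSeq_inv hξ hη h m).1.nonneg 0
  rw [Metric.tendsto_atTop]
  intro c hc
  by_contra! hcon
  have hle : ∀ m, c ≤ remSeq ξ η m 0 := fun m => by
    obtain ⟨n, hn, hcn⟩ := hcon m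
    rw [Real.dist_eq, sub_zero, abs_of_nonneg (h0 n)] at hcn
    exact hcn.trans (remSeq_zero_antitone hξ hη h hn)
  obtain ⟨M, hM⟩ := eventually_atTop.1 (hξ.tendsto_zero.eventually (gt_mem_nhds (half_pos hc)))
  obtain ⟨n, hn, hlt⟩ := frequently_atTop.1
    ((stronglyMajorized_iff.1 (remSeq_inv hξ hη h M).2).2 _ (half_pos hc)) 1
  obtain ⟨n, rfl⟩ : ∃ n', n = n' + 1 := ⟨n - 1, by omega⟩
  exact absurd hlt (not_lt.2 (le_sum_remSeq hξ hη h hle (fun m hm => (hM m hm).le) n M le_rfl))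

end iterate

end

section

/-! ### Rotations in the plane -/

/-- The cosine of the rotation of `diag(a, b)` that produces the diagonal entry `t`. -/
def rotCos (a b t : ℝ) : ℝ := if a = t then 1 else √((t - b) / (a - b))

/-- The sine of the rotation of `diag(a, b)` that produces the diagonal entry `t`. -/
def rotSin (a b t : ℝ) : ℝ := if a = t then 0 else √((a - t) / (a - b))

theorem rotCos_sq_add {a b t : ℝ} (hb : b ≤ t) (ha : t ≤ a) :
    rotCos a b t ^ 2 + rotSin a b t ^ 2 = 1 := by
  unfold rotCos rotSin
  split_ifs with h
  · norm_num
  · have h1 : t < a := lt_of_le_of_ne ha (Ne.symm h)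
    have h2 : 0 < a - b := by linarith
    rw [Real.sq_sqrt (div_nonneg (by linarith) h2.le), Real.sq_sqrt (div_nonneg (by linarith) h2.le)]
    field_simp
    ring

theorem rotCos_sq_mul {a b t : ℝ} (hb : b ≤ t) (ha : t ≤ a) :
    rotCos a b t ^ 2 * a + rotSin a b t ^ 2 * b = t := by
  unfold rotCos rotSin
  split_ifs with h
  · linarith
  · have h1 : t < a := lt_of_le_of_ne ha (Ne.symm h)
    have h2 : 0 < a - b := by linarith
    rw [Real.sq_sqrt (div_nonneg (by linarith) h2.le), Real.sq_sqrt (div_nonneg (by linarith) h2.le)]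
    field_simp
    ring

/-! ### The rotated orthonormal systems -/

variable {H : Type*} [NormedAddCommGroup H] [InnerProductSpace ℂ H]

section

variable (ξ η : ℕ → ℝ)

/-- The index of the `m`-th rotation. -/
def remPivot (m : ℕ) : ℕ := pivot (remSeq ξ η m) (ξ m)

/-- The cosine of the `m`-th rotation. -/
def remCos (m : ℕ) : ℝ :=
  rotCos (remSeq ξ η m (remPivot ξ η m)) (remSeq ξ η m (remPivot ξ η m + 1)) (ξ m)

/-- The sine of the `m`-th rotation. -/
def remSin (m : ℕ) : ℝ :=
  rotSin (remSeq ξ η m (remPivot ξ η m)) (remSeq ξ η m (remPivot ξ η m + 1)) (ξ m)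

/-- The orthonormal system that remains after splitting off `m` vectors. -/
def remVec (e : HilbertBasis ℕ ℂ H) : ℕ → ℕ → H
  | 0 => e
  | m + 1 => merge (remPivot ξ η m)
      (-(remSin ξ η m : ℂ) • remVec e m (remPivot ξ η m) +
        (remCos ξ η m : ℂ) • remVec e m (remPivot ξ η m + 1)) (remVec e m)

/-- The `m`-th vector split off. -/
def splitVec (e : HilbertBasis ℕ ℂ H) (m : ℕ) : H :=
  (remCos ξ η m : ℂ) • remVec ξ η e m (remPivot ξ η m) +
    (remSin ξ η m : ℂ) • remVec ξ η e m (remPivot ξ η m + 1)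

end

section

variable {ξ η : ℕ → ℝ}

theorem remSeq_succ_le (hξ : IsNullDecr ξ) (hη : IsNullDecr η) (h : StronglyMajorized ξ η)
    (m : ℕ) : remSeq ξ η m (remPivot ξ η m + 1) ≤ ξ m := by
  obtain ⟨h1, h2⟩ := remSeq_inv hξ hη h m
  exact h2.pivot_succ_le (hξ.shift m) h1

theorem le_remSeq (hξ : IsNullDecr ξ) (hη : IsNullDecr η) (h : StronglyMajorized ξ η)
    (m : ℕ) : ξ m ≤ remSeq ξ η m (remPivot ξ η m) :=
  (remSeq_inv hξ hη h m).2.le_pivot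

theorem remCos_sq_add (hξ : IsNullDecr ξ) (hη : IsNullDecr η) (h : StronglyMajorized ξ η)
    (m : ℕ) : remCos ξ η m ^ 2 + remSin ξ η m ^ 2 = 1 :=
  rotCos_sq_add (remSeq_succ_le hξ hη h m) (le_remSeq hξ hη h m)

theorem remCos_sq_mul (hξ : IsNullDecr ξ) (hη : IsNullDecr η) (h : StronglyMajorized ξ η)
    (m : ℕ) : remCos ξ η m ^ 2 * remSeq ξ η m (remPivot ξ η m) +
      remSin ξ η m ^ 2 * remSeq ξ η m (remPivot ξ η m + 1) = ξ m :=
  rotCos_sq_mul (remSeq_succ_le hξ hη h m) (le_remSeq hξ hη h m)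

/-- Rotating two members of a system that diagonalizes a form. -/
theorem inner_merge {v : ℕ → H} {T : H →L[ℂ] H} {g : ℕ → ℝ}
    (hv : ∀ i j, ⟪v i, T (v j)⟫_ℂ = if i = j then (g i : ℂ) else 0) (k : ℕ) (c s : ℝ) (i j : ℕ) :
    ⟪merge k (-(s : ℂ) • v k + (c : ℂ) • v (k + 1)) v i,
      T (merge k (-(s : ℂ) • v k + (c : ℂ) • v (k + 1)) v j)⟫_ℂ =
      if i = j then ((merge k (s ^ 2 * g k + c ^ 2 * g (k + 1)) g i : ℝ) : ℂ) else 0 := by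
  have hw : ∀ x, ⟪-(s : ℂ) • v k + (c : ℂ) • v (k + 1), x⟫_ℂ =
      -(s : ℂ) * ⟪v k, x⟫_ℂ + (c : ℂ) * ⟪v (k + 1), x⟫_ℂ := fun x => by
    rw [inner_add_left, inner_smul_left, inner_smul_left]; simp
  have hTw : ∀ x, ⟪x, T (-(s : ℂ) • v k + (c : ℂ) • v (k + 1))⟫_ℂ =
      -(s : ℂ) * ⟪x, T (v k)⟫_ℂ + (c : ℂ) * ⟪x, T (v (k + 1))⟫_ℂ := fun x => by
    rw [map_add, map_smul, map_smul, inner_add_right, inner_smul_right, inner_smul_right]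
  rcases lt_trichotomy i k with hi | hi | hi <;> rcases lt_trichotomy j k with hj | hj | hj
  · simp only [merge_of_lt hi, merge_of_lt hj, hv]
  · subst hj
    rw [merge_of_lt hi, merge_self, hTw, hv, hv, if_neg (by omega), if_neg (by omega),
      if_neg (by omega)]
    simp
  · simp only [merge_of_lt hi, merge_of_gt hj, hv]
    rw [if_neg (by omega), if_neg (by omega)]
  · subst hi
    rw [merge_of_lt hj, merge_self, hw, hv, hv, if_neg (by omega), if_neg (by omega),
      if_neg (by omega)]
    simp
  · subst hi hj
    simp only [merge_self, hw, hTw, hv]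
    simp
    ring
  · subst hi
    rw [merge_of_gt hj, merge_self, hw, hv, hv, if_neg (by omega), if_neg (by omega),
      if_neg (by omega)]
    simp
  · simp only [merge_of_gt hi, merge_of_lt hj, hv]
    rw [if_neg (by omega), if_neg (by omega)]
  · subst hj
    rw [merge_of_gt hi, merge_self, hTw, hv, hv, if_neg (by omega), if_neg (by omega),
      if_neg (by omega)]
    simp
  · simp only [merge_of_gt hi, merge_of_gt hj, hv, add_left_inj]

theorem inner_remVec (e : HilbertBasis ℕ ℂ H) (hξ : IsNullDecr ξ) (hη : IsNullDecr η)
    (h : StronglyMajorized ξ η) (m : ℕ) (i j : ℕ) :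
    ⟪remVec ξ η e m i, remVec ξ η e m j⟫_ℂ = if i = j then 1 else 0 := by
  induction m generalizing i j with
  | zero => exact inner_basis e i j
  | succ m ih =>
    have h1 := inner_merge (v := remVec ξ η e m) (T := ContinuousLinearMap.id ℂ H)
      (g := fun _ => 1) (by simpa using ih) (remPivot ξ η m) (remCos ξ η m) (remSin ξ η m) i j
    have h2 := remCos_sq_add hξ hη h m
    have h3 : ∀ i, merge (remPivot ξ η m) (remSin ξ η m ^ 2 * 1 + remCos ξ η m ^ 2 * 1)
        (fun _ => (1 : ℝ)) i = 1 := fun i => by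
      unfold merge
      split_ifs <;> linarith
    simp only [h3] at h1
    simpa [remVec] using h1

/-- In the remaining system the compression of `diag η` stays diagonal: the form of `diag η`
vanishes between distinct old vectors, and the rotated vector has value `s² a + c² b = a + b - ξ m`,
the entry placed by `splitOff`. -/
theorem inner_remVec_rdiag (e : HilbertBasis ℕ ℂ H) (hξ : IsNullDecr ξ) (hη : IsNullDecr η)
    (h : StronglyMajorized ξ η) (m : ℕ) (i j : ℕ) :
    ⟪remVec ξ η e m i, rdiag e η (remVec ξ η e m j)⟫_ℂ =
      if i = j then (remSeq ξ η m i : ℂ) else 0 := by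
  induction m generalizing i j with
  | zero =>
    rw [remVec, rdiag, inner_diag e hη.bddSeq, inner_basis]
    simp [remSeq]
  | succ m ih =>
    have h1 := inner_merge (v := remVec ξ η e m) (T := rdiag e η) (g := remSeq ξ η m) ih
      (remPivot ξ η m) (remCos ξ η m) (remSin ξ η m) i j
    have h2 := remCos_sq_add hξ hη h m
    have h3 := remCos_sq_mul hξ hη h m
    have h4 : remSin ξ η m ^ 2 * remSeq ξ η m (remPivot ξ η m) +
        remCos ξ η m ^ 2 * remSeq ξ η m (remPivot ξ η m + 1) =
        remSeq ξ η m (remPivot ξ η m) + remSeq ξ η m (remPivot ξ η m + 1) - ξ m := by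
      linear_combination (remSeq ξ η m (remPivot ξ η m) +
        remSeq ξ η m (remPivot ξ η m + 1)) * h2 - h3
    rw [h4] at h1
    exact h1

theorem inner_splitVec_left (e : HilbertBasis ℕ ℂ H) (m : ℕ) (x : H) :
    ⟪splitVec ξ η e m, x⟫_ℂ =
      (remCos ξ η m : ℂ) * ⟪remVec ξ η e m (remPivot ξ η m), x⟫_ℂ +
        (remSin ξ η m : ℂ) * ⟪remVec ξ η e m (remPivot ξ η m + 1), x⟫_ℂ := by
  rw [splitVec, inner_add_left, inner_smul_left, inner_smul_left]; simp

theorem inner_splitVec_self (e : HilbertBasis ℕ ℂ H) (hξ : IsNullDecr ξ) (hη : IsNullDecr η)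
    (h : StronglyMajorized ξ η) (m : ℕ) : ⟪splitVec ξ η e m, splitVec ξ η e m⟫_ℂ = 1 := by
  rw [inner_splitVec_left, splitVec]
  simp only [inner_add_right, inner_smul_right, inner_remVec e hξ hη h]
  have := remCos_sq_add hξ hη h m
  simp
  rw [← sq, ← sq]
  exact_mod_cast this

theorem inner_splitVec_rdiag_self (e : HilbertBasis ℕ ℂ H) (hξ : IsNullDecr ξ)
    (hη : IsNullDecr η) (h : StronglyMajorized ξ η) (m : ℕ) :
    ⟪splitVec ξ η e m, rdiag e η (splitVec ξ η e m)⟫_ℂ = ξ m := by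
  rw [inner_splitVec_left, splitVec]
  simp only [map_add, map_smul, inner_add_right, inner_smul_right, inner_remVec_rdiag e hξ hη h]
  have := remCos_sq_mul hξ hη h m
  simp
  rw [← mul_assoc, ← mul_assoc, ← sq, ← sq]
  exact_mod_cast this

/-- Vectors orthogonal to one of the systems stay orthogonal to the later ones. -/
theorem inner_remVec_eq_zero (e : HilbertBasis ℕ ℂ H) {x : H} {m : ℕ}
    (hx : ∀ j, ⟪remVec ξ η e m j, x⟫_ℂ = 0) {n : ℕ} (hn : m ≤ n) (j : ℕ) :
    ⟪remVec ξ η e n j, x⟫_ℂ = 0 := by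
  induction n, hn using Nat.le_induction generalizing j with
  | base => exact hx j
  | succ n hn ih =>
    rw [remVec, merge]
    split_ifs
    · exact ih j
    · rw [inner_add_left, inner_smul_left, inner_smul_left, ih, ih]; simp
    · exact ih _

theorem inner_splitVec_eq_zero (e : HilbertBasis ℕ ℂ H) {x : H} {m : ℕ}
    (hx : ∀ j, ⟪remVec ξ η e m j, x⟫_ℂ = 0) {n : ℕ} (hn : m ≤ n) :
    ⟪splitVec ξ η e n, x⟫_ℂ = 0 := by
  rw [inner_splitVec_left, inner_remVec_eq_zero e hx hn, inner_remVec_eq_zero e hx hn]; simp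

theorem inner_remVec_splitVec (e : HilbertBasis ℕ ℂ H) (hξ : IsNullDecr ξ) (hη : IsNullDecr η)
    (h : StronglyMajorized ξ η) (m j : ℕ) :
    ⟪remVec ξ η e (m + 1) j, splitVec ξ η e m⟫_ℂ = 0 := by
  have h1 : ∀ i, ⟪remVec ξ η e m i, splitVec ξ η e m⟫_ℂ =
      (if i = remPivot ξ η m then (remCos ξ η m : ℂ) else 0) +
        if i = remPivot ξ η m + 1 then (remSin ξ η m : ℂ) else 0 := fun i => by
    simp only [splitVec, inner_add_right, inner_smul_right, inner_remVec e hξ hη h]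
    simp
  rw [remVec, merge]
  split_ifs with hj hj'
  · rw [h1, if_neg (by omega), if_neg (by omega), add_zero]
  · rw [inner_add_left, inner_smul_left, inner_smul_left, h1, h1]
    simp
    ring
  · rw [h1, if_neg (by omega), if_neg (by omega), add_zero]

theorem orthonormal_splitVec (e : HilbertBasis ℕ ℂ H) (hξ : IsNullDecr ξ) (hη : IsNullDecr η)
    (h : StronglyMajorized ξ η) : Orthonormal ℂ (splitVec ξ η e) := by
  have hlt : ∀ i j, i < j → ⟪splitVec ξ η e j, splitVec ξ η e i⟫_ℂ = 0 := fun i j hij =>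
    inner_splitVec_eq_zero e (inner_remVec_splitVec e hξ hη h i) hij
  rw [orthonormal_iff_ite]
  intro i j
  rcases lt_trichotomy i j with hij | rfl | hij
  · rw [if_neg hij.ne, ← inner_conj_symm, hlt i j hij, map_zero]
  · rw [if_pos rfl, inner_splitVec_self e hξ hη h]
  · rw [if_neg hij.ne', hlt j i hij]

theorem im_inner_remVec (e : HilbertBasis ℕ ℂ H) (m i j : ℕ) :
    (⟪remVec ξ η e m i, e j⟫_ℂ).im = 0 := by
  induction m generalizing i with
  | zero =>
    rw [remVec, inner_basis]
    split_ifs <;> simp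
  | succ m ih =>
    rw [remVec, merge]
    split_ifs
    · exact ih i
    · rw [inner_add_left, inner_smul_left, inner_smul_left]
      simp [ih]
    · exact ih _

theorem im_inner_splitVec (e : HilbertBasis ℕ ℂ H) (m j : ℕ) :
    (⟪splitVec ξ η e m, e j⟫_ℂ).im = 0 := by
  rw [inner_splitVec_left]
  simp [im_inner_remVec]

end

end

section

variable {H : Type*} [NormedAddCommGroup H] [InnerProductSpace ℂ H] {ξ η : ℕ → ℝ}

/-! ### Completeness of the vectors split off -/

section complete

variable {e : HilbertBasis ℕ ℂ H} {x : H}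

theorem inner_remVec_succ_pivot (m : ℕ) :
    ⟪remVec ξ η e (m + 1) (remPivot ξ η m), x⟫_ℂ =
      -(remSin ξ η m : ℂ) * ⟪remVec ξ η e m (remPivot ξ η m), x⟫_ℂ +
        (remCos ξ η m : ℂ) * ⟪remVec ξ η e m (remPivot ξ η m + 1), x⟫_ℂ := by
  rw [remVec, merge_self, inner_add_left, inner_smul_left, inner_smul_left]; simp

/-- In the plane of the `m`-th rotation, a vector orthogonal to the one split off has a component
only along the other rotated vector. -/
theorem inner_remVec_of_orthogonal (hξ : IsNullDecr ξ) (hη : IsNullDecr η)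
    (h : StronglyMajorized ξ η) (hx : ∀ m, ⟪splitVec ξ η e m, x⟫_ℂ = 0) (m : ℕ) :
    ⟪remVec ξ η e m (remPivot ξ η m), x⟫_ℂ =
        -(remSin ξ η m : ℂ) * ⟪remVec ξ η e (m + 1) (remPivot ξ η m), x⟫_ℂ ∧
      ⟪remVec ξ η e m (remPivot ξ η m + 1), x⟫_ℂ =
        (remCos ξ η m : ℂ) * ⟪remVec ξ η e (m + 1) (remPivot ξ η m), x⟫_ℂ := by
  have h1 := hx m
  rw [inner_splitVec_left] at h1
  have h2 : (remCos ξ η m : ℂ) ^ 2 + (remSin ξ η m : ℂ) ^ 2 = 1 := by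
    exact_mod_cast remCos_sq_add hξ hη h m
  rw [inner_remVec_succ_pivot]
  constructor
  · linear_combination (-⟪remVec ξ η e m (remPivot ξ η m), x⟫_ℂ) * h2 +
      (remCos ξ η m : ℂ) * h1
  · linear_combination (-⟪remVec ξ η e m (remPivot ξ η m + 1), x⟫_ℂ) * h2 +
      (remSin ξ η m : ℂ) * h1

/-- A vector orthogonal to everything split off loses no mass when the system shrinks. -/
theorem hasSum_remVec (hξ : IsNullDecr ξ) (hη : IsNullDecr η)
    (h : StronglyMajorized ξ η) (hx : ∀ m, ⟪splitVec ξ η e m, x⟫_ℂ = 0) (m : ℕ) :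
    HasSum (fun j => ‖⟪remVec ξ η e m j, x⟫_ℂ‖ ^ 2) (‖x‖ ^ 2) := by
  induction m with
  | zero => exact hasSum_sq_norm_inner e x
  | succ m ih =>
    obtain ⟨h1, h2⟩ := inner_remVec_of_orthogonal hξ hη h hx m
    have h3 := remCos_sq_add hξ hη h m
    have := hasSum_merge (k := remPivot ξ η m)
      (a := ‖⟪remVec ξ η e (m + 1) (remPivot ξ η m), x⟫_ℂ‖ ^ 2) (fun j => by positivity) ?_ ih
    · convert this using 2 with j
      unfold merge
      split_ifs with hj hj'
      · rw [remVec, merge_of_lt hj]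
      · rw [hj']
      · rw [remVec, merge_of_gt (by omega)]
    · rw [h1, h2, norm_mul, norm_mul, mul_pow, mul_pow]
      simp only [norm_neg, Complex.norm_real, Real.norm_eq_abs, sq_abs]
      linear_combination (-‖⟪remVec ξ η e (m + 1) (remPivot ξ η m), x⟫_ℂ‖ ^ 2) * h3

theorem remSeq_succ (m : ℕ) : remSeq ξ η (m + 1) = merge (remPivot ξ η m)
    (remSeq ξ η m (remPivot ξ η m) + remSeq ξ η m (remPivot ξ η m + 1) - ξ m)
    (remSeq ξ η m) := rfl

/-- The quadratic form of `diag η` at `x` is likewise expressed by every remaining system. -/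
theorem hasSum_remSeq_mul_remVec (hξ : IsNullDecr ξ) (hη : IsNullDecr η)
    (h : StronglyMajorized ξ η) (hx : ∀ m, ⟪splitVec ξ η e m, x⟫_ℂ = 0) {Q : ℝ}
    (hQ : HasSum (fun j => η j * ‖⟪e j, x⟫_ℂ‖ ^ 2) Q) (m : ℕ) :
    HasSum (fun j => remSeq ξ η m j * ‖⟪remVec ξ η e m j, x⟫_ℂ‖ ^ 2) Q := by
  induction m with
  | zero => exact hQ
  | succ m ih =>
    obtain ⟨h1, h2⟩ := inner_remVec_of_orthogonal hξ hη h hx m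
    have h3 := remCos_sq_add hξ hη h m
    have h4 := remCos_sq_mul hξ hη h m
    have := hasSum_merge (k := remPivot ξ η m)
      (a := (remSeq ξ η m (remPivot ξ η m) + remSeq ξ η m (remPivot ξ η m + 1) - ξ m) *
        ‖⟪remVec ξ η e (m + 1) (remPivot ξ η m), x⟫_ℂ‖ ^ 2)
      (fun j => mul_nonneg ((remSeq_inv hξ hη h m).1.nonneg j) (by positivity)) ?_ ih
    · convert this using 2 with j
      unfold merge
      split_ifs with hj hj'
      · rw [remVec, merge_of_lt hj, remSeq_succ, merge_of_lt hj]
      · rw [hj', remSeq_succ, merge_self]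
      · rw [remVec, merge_of_gt (by omega), remSeq_succ, merge_of_gt (by omega)]
    · rw [h1, h2, norm_mul, norm_mul, mul_pow, mul_pow]
      simp only [norm_neg, Complex.norm_real, Real.norm_eq_abs, sq_abs]
      linear_combination (‖⟪remVec ξ η e (m + 1) (remPivot ξ η m), x⟫_ℂ‖ ^ 2) *
        (h4 - (remSeq ξ η m (remPivot ξ η m) + remSeq ξ η m (remPivot ξ η m + 1)) * h3)

/-- The form `Q` of `diag η` at `x` is at most `remSeq ξ η m 0 * ‖x‖²` for every `m`, hence `Q = 0`.
This kills the components of `x` at nonzero entries of the remainders; those at zero entries need a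
separate induction. -/
theorem eq_zero_of_inner_splitVec (hξ : IsNullDecr ξ) (hη : IsNullDecr η)
    (h : StronglyMajorized ξ η) (hx : ∀ m, ⟪splitVec ξ η e m, x⟫_ℂ = 0) : x = 0 := by
  obtain ⟨Q, hQ⟩ : ∃ Q, HasSum (fun j => η j * ‖⟪e j, x⟫_ℂ‖ ^ 2) Q := by
    refine ⟨_, (Summable.of_nonneg_of_le
      (fun j => mul_nonneg (hη.nonneg j) (by positivity)) (fun j => ?_)
      ((hasSum_sq_norm_inner e x).summable.mul_left (η 0))).hasSum⟩
    gcongr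
    exact hη.le_zero_index j
  have hQm := hasSum_remSeq_mul_remVec hξ hη h hx hQ
  have hnn : ∀ m j, 0 ≤ remSeq ξ η m j * ‖⟪remVec ξ η e m j, x⟫_ℂ‖ ^ 2 := fun m j =>
    mul_nonneg ((remSeq_inv hξ hη h m).1.nonneg j) (by positivity)
  have hQ0 : Q = 0 := by
    refine le_antisymm ?_ ((hQm 0).nonneg (hnn 0))
    refine ge_of_tendsto' (f := fun m => remSeq ξ η m 0 * ‖x‖ ^ 2) (b := Q) (x := atTop)
      (by simpa using (remSeq_zero_tendsto hξ hη h).mul_const (‖x‖ ^ 2)) fun m => ?_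
    refine hasSum_le (fun j => ?_) (hQm m) ((hasSum_remVec hξ hη h hx m).mul_left _)
    gcongr
    exact (remSeq_inv hξ hη h m).1.le_zero_index j
  have hpos : ∀ m j, remSeq ξ η m j ≠ 0 → ⟪remVec ξ η e m j, x⟫_ℂ = 0 := fun m j hj => by
    have h1 := (hasSum_zero_iff_of_nonneg (hnn m)).1 (hQ0 ▸ hQm m)
    have h2 := congrFun h1 j
    simpa [hj] using h2
  -- Induction on the position, for all stages at once: a vector at a zero entry is either split off
  -- unchanged or tied to position `p - 1` of the next stage.
  have key : ∀ p m, ⟪remVec ξ η e m p, x⟫_ℂ = 0 := by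
    intro p
    induction p using Nat.strong_induction_on with
    | _ p ih =>
    intro m
    by_cases hp : remSeq ξ η m p = 0
    swap
    · exact hpos m p hp
    obtain ⟨h1, h2⟩ := remSeq_inv hξ hη h m
    rcases p with _ | p
    · have h3 : ξ m = 0 := le_antisymm (hp ▸ h2.zero_le) (hξ.nonneg m)
      have h4 : remSeq ξ η m (0 + 1) ≤ ξ m := by
        rw [h3, ← hp]; exact h1.le_zero_index _
      have h5 : remPivot ξ η m = 0 := Nat.le_zero.1 (pivot_le h4)
      have h6 := hx m
      rw [inner_splitVec_left, remCos, remSin, h5, hp, h3, rotCos, rotSin] at h6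
      simpa using h6
    · have h3 : remPivot ξ η m ≤ p := pivot_le (by rw [hp]; exact hξ.nonneg m)
      rcases h3.eq_or_lt with h4 | h4
      · have h5 := (inner_remVec_of_orthogonal hξ hη h hx m).2
        rw [h4, ih p p.lt_succ_self, mul_zero] at h5
        exact h5
      · have h5 := ih p p.lt_succ_self (m + 1)
        rwa [remVec, merge_of_gt h4] at h5
  exact ext_inner_basis e fun n => by
    rw [inner_zero_right]; exact key n 0

end complete

/-! ### Block structure -/

/-- An agreement of partial sums is a wall that no rotation crosses: at every earlier stage, the
vectors beyond it are untouched and those before it have no component beyond it. -/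
theorem remVec_of_sum_eq (e : HilbertBasis ℕ ℂ H) (hξ : IsNullDecr ξ) (hη : IsNullDecr η)
    (h : StronglyMajorized ξ η) {m L : ℕ}
    (hsum : ∑ j ∈ Finset.range (m + L), (η j - ξ j) = 0) :
    ∑ j ∈ Finset.range L, (remSeq ξ η m j - ξ (m + j)) = 0 ∧
      (∀ j ≥ L, remVec ξ η e m j = e (m + j)) ∧
      ∀ j < L, ∀ i ≥ m + L, ⟪remVec ξ η e m j, e i⟫_ℂ = 0 := by
  induction m generalizing L with
  | zero =>
    refine ⟨by simpa [remSeq] using hsum, fun j _ => by simp [remVec], fun j hj i hi => ?_⟩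
    rw [remVec, inner_basis, if_neg (by omega)]
  | succ m ih =>
    obtain ⟨h1, h2, h3⟩ := ih (L := L + 1) (by rwa [show m + (L + 1) = m + 1 + L by omega])
    obtain ⟨i1, i2⟩ := remSeq_inv hξ hη h m
    have i1' := hξ.shift m
    rcases lt_or_ge (remPivot ξ η m) L with hk | hk
    · refine ⟨?_, fun j hj => ?_, fun j hj i hi => ?_⟩
      · have := StronglyMajorized.sum_splitOff (ξ := fun j => ξ (m + j)) (η := remSeq ξ η m)
          (n := L) hk
        rw [h1] at this
        simpa only [remSeq, add_zero, show ∀ j, m + 1 + j = m + (j + 1) by omega] using this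
      · rw [remVec, merge_of_gt (by omega), h2 _ (by omega)]
        congr 1; omega
      · rw [remVec, merge]
        split_ifs
        · exact h3 _ (by omega) _ (by omega)
        · rw [inner_add_left, inner_smul_left, inner_smul_left, h3 _ (by omega) _ (by omega),
            h3 _ (by omega) _ (by omega)]
          simp
        · exact h3 _ (by omega) _ (by omega)
    -- A pivot at or past the wall would make the zero defect dominate the first difference. Hence
    -- the head equals `ξ m`, the pivot is `0`, and the rotation is trivial.
    · have h4 := i2.sub_le_sum i1' i1 (n := L) hk
      rw [h1, add_zero] at h4
      have h5 : remSeq ξ η m 0 = ξ m := le_antisymm (by linarith) i2.zero_le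
      have h6 : remPivot ξ η m = 0 :=
        Nat.le_zero.1 (pivot_le (h5 ▸ i1.le_zero_index (0 + 1)))
      obtain rfl : L = 0 := by omega
      refine ⟨by simp, fun j _ => ?_, fun j hj => absurd hj (by omega)⟩
      rw [remVec, remCos, remSin, h6, h5, rotCos, rotSin, if_pos rfl, if_pos rfl]
      rcases Nat.eq_zero_or_pos j with rfl | hj
      · rw [merge_self]
        simpa using h2 1 le_rfl
      · rw [merge_of_gt hj, h2 _ (by omega)]
        congr 1; omega

/-- Vectors split off before stage `N` live in the first `N` coordinates. At stage `N` the remaining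
system is exactly `e N, e (N + 1), …`, so the later ones avoid these coordinates. -/
theorem inner_splitVec_eq_zero_of_sum_eq (e : HilbertBasis ℕ ℂ H) (hξ : IsNullDecr ξ)
    (hη : IsNullDecr η) (h : StronglyMajorized ξ η) {N : ℕ}
    (hsum : ∑ j ∈ Finset.range N, ξ j = ∑ j ∈ Finset.range N, η j) {m i : ℕ}
    (hne : ⟪splitVec ξ η e m, e i⟫_ℂ ≠ 0) : m < N ↔ i < N := by
  have hsum' : ∑ j ∈ Finset.range N, (η j - ξ j) = 0 := by
    rw [Finset.sum_sub_distrib, hsum, sub_self]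
  constructor
  · intro hm
    by_contra! hi
    obtain ⟨L, rfl⟩ := Nat.exists_eq_add_of_lt hm
    obtain ⟨h1, h2, h3⟩ := remVec_of_sum_eq e hξ hη h (m := m) (L := L + 1) hsum'
    obtain ⟨i1, i2⟩ := remSeq_inv hξ hη h m
    refine hne ?_
    rcases lt_or_ge (remPivot ξ η m) L with hk | hk
    · rw [inner_splitVec_left, h3 _ (by omega) _ (by omega), h3 _ (by omega) _ (by omega)]
      simp
    · have h4 := i2.sub_le_sum (hξ.shift m) i1 (n := L) hk
      rw [h1, add_zero] at h4
      have h5 : remSeq ξ η m 0 = ξ m := le_antisymm (by linarith) i2.zero_le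
      have h6 : remPivot ξ η m = 0 :=
        Nat.le_zero.1 (pivot_le (h5 ▸ i1.le_zero_index (0 + 1)))
      rw [inner_splitVec_left, remCos, remSin, h6, h5, rotCos, rotSin, if_pos rfl, if_pos rfl,
        h3 _ (by omega) _ (by omega)]
      simp
  · intro hi
    by_contra! hm
    obtain ⟨-, h2, -⟩ := remVec_of_sum_eq e hξ hη h (m := N) (L := 0) hsum'
    refine hne (inner_splitVec_eq_zero e (m := N) (fun j => ?_) hm)
    rw [h2 j (Nat.zero_le j), inner_basis, if_neg (by omega)]

end

/-! ### Passing between matrices, diagonals and majorization -/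

section

variable {H : Type*} [NormedAddCommGroup H] [InnerProductSpace ℂ H] {ξ η : ℕ → ℝ}

/-! ### Diagonals and orthogonal matrices -/

theorem norm_entry_le (e : HilbertBasis ℕ ℂ H) (A : H →L[ℂ] H) (i j : ℕ) :
    ‖entry e A i j‖ ≤ ‖A‖ := by
  refine (norm_inner_le_norm _ _).trans ?_
  rw [e.orthonormal.1, one_mul]
  simpa [e.orthonormal.1] using A.le_opNorm (e j)

theorem diag_injective (e : HilbertBasis ℕ ℂ H) {ρ σ : ℕ → ℂ} (hρ : BddSeq ρ) (hσ : BddSeq σ)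
    (h : diag e ρ = diag e σ) : ρ = σ := by
  ext n
  have h1 := congrArg (fun A => ⟪e n, A (e n)⟫_ℂ) h
  simpa [inner_diag e hρ, inner_diag e hσ, e.orthonormal.1] using h1

variable [CompleteSpace H]

/-! ### Orthogonal matrices from strong majorization -/

/-- The complete orthonormal system `splitVec` supplies the rows of `U`, and its coordinates are
real. -/
theorem exists_orthogonal (e : HilbertBasis ℕ ℂ H) (hξ : IsNullDecr ξ) (hη : IsNullDecr η)
    (h : StronglyMajorized ξ η) :
    ∃ U : H →L[ℂ] H, IsOrthogonal e U ∧ ∀ i, ContinuousLinearMap.adjoint U (e i) =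
      splitVec ξ η e i := by
  have hbot : (Submodule.span ℂ (Set.range (splitVec ξ η e)))ᗮ = ⊥ := by
    rw [Submodule.eq_bot_iff]
    intro x hx
    exact eq_zero_of_inner_splitVec hξ hη h fun m =>
      (Submodule.mem_orthogonal _ _).1 hx _ (Submodule.subset_span ⟨m, rfl⟩)
  set f := HilbertBasis.mkOfOrthogonalEqBot (orthonormal_splitVec e hξ hη h) hbot with hf
  have hfv : ∀ i, f i = splitVec ξ η e i := fun i => by rw [hf]; simp
  let W : H ≃ₗᵢ[ℂ] H := f.repr.trans e.repr.symm
  have hW : ∀ i, W.symm (e i) = splitVec ξ η e i := fun i => by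
    rw [← hfv i, LinearIsometryEquiv.symm_apply_eq]
    change e i = e.repr.symm (f.repr (f i))
    rw [f.repr_self, e.repr_symm_single]
  have hadj : ∀ i, ContinuousLinearMap.adjoint (W : H →L[ℂ] H) (e i) = splitVec ξ η e i := by
    intro i
    rw [← hW i]
    refine ext_inner_left ℂ fun x => ?_
    rw [ContinuousLinearMap.adjoint_inner_right]
    change ⟪W x, e i⟫_ℂ = _
    rw [← LinearIsometryEquiv.inner_map_map W x, LinearIsometryEquiv.apply_symm_apply]
  refine ⟨W, ⟨?_, fun i j => ?_⟩, hadj⟩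
  · have := (Unitary.linearIsometryEquiv.symm W).2
    rwa [Unitary.coe_symm_linearIsometryEquiv_apply] at this
  · rw [entry, ← ContinuousLinearMap.adjoint_inner_left, hadj, im_inner_splitVec]

theorem entry_eq_inner_adjoint (e : HilbertBasis ℕ ℂ H) (L : H →L[ℂ] H) (i j : ℕ) :
    entry e L i j = ⟪ContinuousLinearMap.adjoint L (e i), e j⟫_ℂ := by
  rw [entry, ContinuousLinearMap.adjoint_inner_left]

/-! ### Diagonals of conjugates of diagonal operators -/

theorem entry_conj_self (e : HilbertBasis ℕ ℂ H) (L : H →L[ℂ] H) (hη : IsNullDecr η) (i : ℕ) :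
    entry e (L ∘L rdiag e η ∘L ContinuousLinearMap.adjoint L) i i =
      (∑' j, ‖entry e L i j‖ ^ 2 * η j : ℝ) ∧
    Summable fun j => ‖entry e L i j‖ ^ 2 * η j := by
  set y := ContinuousLinearMap.adjoint L (e i) with hy
  have h1 : entry e (L ∘L rdiag e η ∘L ContinuousLinearMap.adjoint L) i i =
      ⟪y, rdiag e η y⟫_ℂ := by
    rw [entry, hy, ContinuousLinearMap.adjoint_inner_left]; rfl
  have h2 := inner_rdiag_self e hη.bddSeq y
  have h3 : ∀ j, ‖entry e L i j‖ = ‖⟪e j, y⟫_ℂ‖ := fun j => by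
    rw [entry_eq_inner_adjoint, norm_inner_symm]
  simp only [h3]
  refine ⟨?_, h2.summable⟩
  rw [h1, h2.tsum_eq]
  refine (Complex.conj_eq_iff_re.1 ?_).symm
  rw [inner_conj_symm, inner_rdiag_symm e hη.bddSeq]

/-- The diagonal of `L diag(η) L*` is the image of `η` under the Schur square of `L`. -/
theorem rdiag_eq_expectation_iff (e : HilbertBasis ℕ ℂ H) (L : H →L[ℂ] H) (hξ : IsNullDecr ξ)
    (hη : IsNullDecr η) :
    rdiag e ξ = expectation e (L ∘L rdiag e η ∘L ContinuousLinearMap.adjoint L) ↔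
      IsImage ξ (fun i j => ‖entry e L i j‖ ^ 2) η := by
  constructor
  · intro h i
    have h1 := congrFun (diag_injective e hξ.bddSeq ⟨_, fun n => norm_entry_le e _ n n⟩ h) i
    obtain ⟨h2, h3⟩ := entry_conj_self e L hη i
    rw [h2] at h1
    have h4 : ξ i = ∑' j, ‖entry e L i j‖ ^ 2 * η j := by exact_mod_cast h1
    rw [h4]
    exact h3.hasSum
  · intro h
    rw [rdiag, expectation]
    congr 1
    ext i
    rw [(entry_conj_self e L hη i).1, (h i).tsum_eq]

theorem isSubstochastic_of_contraction (e : HilbertBasis ℕ ℂ H) {L : H →L[ℂ] H} (hL : ‖L‖ ≤ 1) :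
    IsSubstochastic fun i j => ‖entry e L i j‖ ^ 2 := by
  have hrow : ∀ i, HasSum (fun j => ‖entry e L i j‖ ^ 2)
      (‖ContinuousLinearMap.adjoint L (e i)‖ ^ 2) := fun i => by
    convert hasSum_sq_norm_inner e (ContinuousLinearMap.adjoint L (e i)) using 3 with j
    rw [entry_eq_inner_adjoint, norm_inner_symm]
  have hcol : ∀ j, HasSum (fun i => ‖entry e L i j‖ ^ 2) (‖L (e j)‖ ^ 2) := fun j =>
    hasSum_sq_norm_inner e (L (e j))
  have hle : ∀ (A : H →L[ℂ] H) i, ‖A‖ ≤ 1 → ‖A (e i)‖ ^ 2 ≤ 1 := fun A i hA => by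
    have h1 := A.le_opNorm (e i)
    rw [e.orthonormal.1, mul_one] at h1
    exact pow_le_one₀ (norm_nonneg _) (h1.trans hA)
  refine ⟨fun i j => by positivity, fun i => (hrow i).summable, fun i => ?_,
    fun j => (hcol j).summable, fun j => ?_⟩
  · rw [(hrow i).tsum_eq]
    exact hle _ _ (by rwa [LinearIsometryEquiv.norm_map])
  · rw [(hcol j).tsum_eq]
    exact hle _ _ hL

theorem IsOrthogonal.norm_le_one {e : HilbertBasis ℕ ℂ H} {U : H →L[ℂ] H}
    (hU : IsOrthogonal e U) : ‖U‖ ≤ 1 :=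
  have : Nontrivial H := ⟨e 0, 0, e.orthonormal.ne_zero 0⟩
  (CStarRing.norm_of_mem_unitary hU.1).le

/-- An orthogonal matrix that maps `η` to `ξ` and respects the indices where the partial sums
of the two sequences agree. -/
theorem StronglyMajorized.exists_isImage (e : HilbertBasis ℕ ℂ H) (hξ : IsNullDecr ξ)
    (hη : IsNullDecr η) (h : StronglyMajorized ξ η) :
    ∃ U : H →L[ℂ] H, IsOrthogonal e U ∧ IsImage ξ (fun i j => ‖entry e U i j‖ ^ 2) η ∧
      ∀ N, ∑ j ∈ Finset.range N, ξ j = ∑ j ∈ Finset.range N, η j →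
        ∀ i j, entry e U i j ≠ 0 → (i < N ↔ j < N) := by
  obtain ⟨U, hU, hUe⟩ := exists_orthogonal e hξ hη h
  refine ⟨U, hU, fun i => ?_, fun N hN i j hij => ?_⟩
  · have h1 := inner_rdiag_self e hη.bddSeq (splitVec ξ η e i)
    rw [inner_splitVec_rdiag_self e hξ hη h, Complex.ofReal_re] at h1
    convert h1 using 3 with j
    beta_reduce
    rw [entry_eq_inner_adjoint, hUe, norm_inner_symm]
  · rw [entry_eq_inner_adjoint, hUe] at hij
    exact inner_splitVec_eq_zero_of_sum_eq e hξ hη h hN hij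

theorem BlockMajorized.stronglyMajorized (h : BlockMajorized ξ η) : StronglyMajorized ξ η := by
  obtain ⟨hm, n, hn, hsum⟩ := h
  refine stronglyMajorized_iff.2 ⟨hm, fun δ hδ => frequently_atTop.2 fun N => ?_⟩
  refine ⟨n N, hn.le_apply, ?_⟩
  rw [Finset.sum_sub_distrib, hsum, sub_self]
  exact hδ

theorem BlockMajorized.exists_isImage (e : HilbertBasis ℕ ℂ H) (hξ : IsNullDecr ξ)
    (hη : IsNullDecr η) (h : BlockMajorized ξ η) :
    ∃ U : H →L[ℂ] H, IsBlockOrthogonal e U ∧ IsImage ξ (fun i j => ‖entry e U i j‖ ^ 2) η := by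
  obtain ⟨U, hU, hI, hB⟩ := h.stronglyMajorized.exists_isImage e hξ hη
  obtain ⟨-, n, hn, hsum⟩ := h
  -- The block ends must start at `0`, where the empty partial sums agree; so the first given index
  -- is replaced by `0`.
  refine ⟨U, ⟨hU, fun k => if k = 0 then 0 else n k, by simp, fun a b hab => ?_, ?_⟩, hI⟩
  · have h1 := hn hab
    simp only
    split_ifs <;> omega
  · intro i j hij
    have hN : ∀ k, ∑ j ∈ Finset.range (if k = 0 then 0 else n k), ξ j =
        ∑ j ∈ Finset.range (if k = 0 then 0 else n k), η j := fun k => by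
      split_ifs
      · simp
      · exact hsum k
    have hex : ∃ k, i < n (k + 1) := ⟨i, (Nat.lt_succ_self i).trans_le hn.le_apply⟩
    classical
    have hk : i < if Nat.find hex + 1 = 0 then 0 else n (Nat.find hex + 1) := by
      simpa using Nat.find_spec hex
    have hk' : ¬ i < if Nat.find hex = 0 then 0 else n (Nat.find hex) := by
      split_ifs with h0
      · omega
      · obtain ⟨k, hk⟩ := Nat.exists_eq_succ_of_ne_zero h0
        rw [hk]
        exact Nat.find_min hex (by omega)
    have h1 := hB _ (hN (Nat.find hex + 1)) i j hij
    have h2 := hB _ (hN (Nat.find hex)) i j hij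
    exact ⟨Nat.find hex, ⟨not_lt.1 hk', hk⟩, not_lt.1 (h2.not.1 hk'), h1.1 hk⟩

/-! ### The characteristic set of the am-closure -/

/-- The block majorant is dominated by `η` plus a summable sequence, whose diagonal operator is
trace class; this is where the ideal has to contain `𝓛₁`. -/
theorem exists_blockMajorized_mem_charSet (e : HilbertBasis ℕ ℂ H)
    {I : TwoSidedIdeal (H →L[ℂ] H)} (hI : ∀ X : H →L[ℂ] H, IsTraceClass e X → X ∈ I)
    (hξ : IsNullDecr ξ) (hη : η ∈ charSet I) (h : StronglyMajorized ξ η) :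
    ∃ ζ ∈ charSet I, BlockMajorized ξ ζ := by
  obtain ⟨ζ, hζ, hb, ρ, hρ0, hρs, hle⟩ :=
    exists_blockMajorized_le_add_summable hξ (charSet_isNullDecr hη) h
  refine ⟨ζ, (mem_charSet_iff e I).2 ⟨hζ, ?_⟩, hb⟩
  obtain ⟨h1, h2⟩ := (mem_charSet_iff e I).1 hη
  have hρb : BddSeq fun n => (ρ n : ℂ) :=
    BddSeq.ofReal (K := ∑' n, ρ n) fun n => by
      rw [abs_of_nonneg (hρ0 n)]
      exact hρs.le_tsum n fun j _ => hρ0 j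
  have h3 : rdiag e (fun n => η n + ρ n) ∈ I := by
    rw [rdiag_add e h1.bddSeq hρb]
    exact I.add_mem h2 (hI _ (isTraceClass_rdiag e hρ0 hρs))
  refine rdiag_mem_of_le e (BddSeq.ofReal (K := η 0 + ∑' n, ρ n) fun n => ?_) h3 (M := 1)
    (fun n => ?_) fun n => add_nonneg (h1.nonneg n) (hρ0 n)
  · rw [abs_of_nonneg (add_nonneg (h1.nonneg n) (hρ0 n))]
    exact add_le_add (h1.le_zero_index n) (hρs.le_tsum n fun j _ => hρ0 j)
  · rw [abs_of_nonneg (hζ.nonneg n), one_mul]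
    exact hle n

end

end

end AMClosure

/-! ### The two cycles of implications -/

open AMClosure in
theorem theorem8p1 {H : Type*} [NormedAddCommGroup H] [InnerProductSpace ℂ H]
    [CompleteSpace H] (e : HilbertBasis ℕ ℂ H) (I : TwoSidedIdeal (H →L[ℂ] H))
    (ξ : ℕ → ℝ) (hξ : AMClosure.IsNullDecr ξ) :
    List.TFAE
      [ ξ ∈ AMClosure.charSet (AMClosure.amClosure e I),
        ∃ η ∈ AMClosure.charSet I, AMClosure.Majorized ξ η,
        ∃ η ∈ AMClosure.charSet I, AMClosure.StronglyMajorized ξ η,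
        ∃ η ∈ AMClosure.charSet I, ∃ P : Matrix ℕ ℕ ℝ,
          AMClosure.IsSubstochastic P ∧ AMClosure.IsImage ξ P η,
        ∃ η ∈ AMClosure.charSet I, ∃ Q : Matrix ℕ ℕ ℝ,
          AMClosure.IsOrthostochastic e Q ∧ AMClosure.IsImage ξ Q η,
        ∃ η ∈ AMClosure.charSet I, ∃ L : H →L[ℂ] H, ‖L‖ ≤ 1 ∧
          AMClosure.rdiag e ξ = AMClosure.expectation e
            (L ∘L AMClosure.rdiag e η ∘L ContinuousLinearMap.adjoint L),
        ∃ η ∈ AMClosure.charSet I, ∃ U : H →L[ℂ] H, AMClosure.IsOrthogonal e U ∧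
          AMClosure.rdiag e ξ = AMClosure.expectation e
            (U ∘L AMClosure.rdiag e η ∘L ContinuousLinearMap.adjoint U) ] ∧
    ((∀ X : H →L[ℂ] H, AMClosure.IsTraceClass e X → X ∈ I) →
      List.TFAE
        [ ξ ∈ AMClosure.charSet (AMClosure.amClosure e I),
          ∃ η ∈ AMClosure.charSet I, AMClosure.BlockMajorized ξ η,
          ∃ η ∈ AMClosure.charSet I, ∃ Q : Matrix ℕ ℕ ℝ,
            AMClosure.IsBlockOrthostochastic e Q ∧ AMClosure.IsImage ξ Q η,
          ∃ η ∈ AMClosure.charSet I, ∃ U : H →L[ℂ] H, AMClosure.IsBlockOrthogonal e U ∧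
            AMClosure.rdiag e ξ = AMClosure.expectation e
              (U ∘L AMClosure.rdiag e η ∘L ContinuousLinearMap.adjoint U) ]) := by
  have hstrong : (∃ η ∈ charSet I, Majorized ξ η) → ∃ η ∈ charSet I, StronglyMajorized ξ η := by
    rintro ⟨η, hη, h⟩
    obtain ⟨ζ, hζ, hle, hs⟩ := exists_stronglyMajorized_le hξ (charSet_isNullDecr hη) h
    exact ⟨ζ, charSet_of_le e hη hζ (M := 1) fun n => by simpa using hle n, hs⟩
  have hclosure := mem_charSet_amClosure_iff e I hξ
  have hcontr : ∀ η ∈ charSet I, ∀ L : H →L[ℂ] H, ‖L‖ ≤ 1 →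
      rdiag e ξ = expectation e (L ∘L rdiag e η ∘L ContinuousLinearMap.adjoint L) →
      ∃ P : Matrix ℕ ℕ ℝ, IsSubstochastic P ∧ IsImage ξ P η := fun η hη L hL h =>
    ⟨_, isSubstochastic_of_contraction e hL,
      (rdiag_eq_expectation_iff e L hξ (charSet_isNullDecr hη)).1 h⟩
  refine ⟨?_, fun hI => ?_⟩
  · tfae_have 1 ↔ 2 := hclosure
    tfae_have 2 → 3 := hstrong
    tfae_have 3 → 5 := by
      rintro ⟨η, hη, h⟩
      obtain ⟨U, hU, hQ, -⟩ := h.exists_isImage e hξ (charSet_isNullDecr hη)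
      exact ⟨η, hη, _, ⟨U, hU, fun _ _ => rfl⟩, hQ⟩
    tfae_have 5 → 7 := by
      rintro ⟨η, hη, Q, ⟨U, hU, hQ⟩, h⟩
      obtain rfl : Q = fun i j => ‖entry e U i j‖ ^ 2 := funext fun i => funext fun j => hQ i j
      exact ⟨η, hη, U, hU, (rdiag_eq_expectation_iff e U hξ (charSet_isNullDecr hη)).2 h⟩
    tfae_have 7 → 6 := by
      rintro ⟨η, hη, U, hU, h⟩
      exact ⟨η, hη, U, hU.norm_le_one, h⟩
    tfae_have 6 → 4 := by
      rintro ⟨η, hη, L, hL, h⟩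
      exact ⟨η, hη, hcontr η hη L hL h⟩
    tfae_have 4 → 2 := by
      rintro ⟨η, hη, P, hP, h⟩
      exact ⟨η, hη, hP.majorized (charSet_isNullDecr hη) h⟩
    tfae_finish
  · tfae_have 1 → 2 := by
      intro h
      obtain ⟨η, hη, hs⟩ := hstrong (hclosure.1 h)
      exact exists_blockMajorized_mem_charSet e hI hξ hη hs
    tfae_have 2 → 3 := by
      rintro ⟨η, hη, h⟩
      obtain ⟨U, hU, hQ⟩ := h.exists_isImage e hξ (charSet_isNullDecr hη)
      exact ⟨η, hη, _, ⟨U, hU, fun _ _ => rfl⟩, hQ⟩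
    tfae_have 3 → 4 := by
      rintro ⟨η, hη, Q, ⟨U, hU, hQ⟩, h⟩
      obtain rfl : Q = fun i j => ‖entry e U i j‖ ^ 2 := funext fun i => funext fun j => hQ i j
      exact ⟨η, hη, U, hU, (rdiag_eq_expectation_iff e U hξ (charSet_isNullDecr hη)).2 h⟩
    tfae_have 4 → 1 := by
      rintro ⟨η, hη, U, hU, h⟩
      obtain ⟨P, hP, hPη⟩ := hcontr η hη U hU.1.norm_le_one h
      exact hclosure.2 ⟨η, hη, hP.majorized (charSet_isNullDecr hη) hPη⟩
    tfae_finish
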